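/- Let $0<q<1$. For $Y\in\{\widetilde X,\widetilde\Xi\}$ let $\mathrm{Pol}(Y)_q$ be the unital $\mathbb C$-algebra with generators $t_{11},t_{12},t_{21},t_{22}$ and relations $t_{11}t_{12}=qt_{12}t_{11}$, $t_{21}t_{22}=qt_{22}t_{21}$, $t_{11}t_{21}=qt_{21}t_{11}$, $t_{12}t_{22}=qt_{22}t_{12}$, $t_{12}t_{21}=t_{21}t_{12}$, $t_{11}t_{22}-t_{22}t_{11}=(q-q^{-1})t_{12}t_{21}$ and $t_{11}t_{22}-qt_{12}t_{21}=c$, where $c=1$ for $\widetilde X$ and $c=0$ for $\widetilde\Xi$. Put $t_{11}^*=-t_{22}$, $t_{12}^*=-qt_{21}$, $x=t_{12}t_{12}^*$. Every $f\in\mathrm{Pol}(Y)_q$ has a unique (finite) decomposition $$f=\sum t_{11}^{i_1}t_{12}^{i_2}\,\psi_{i_1i_2j_1j_2}(x)\,t_{12}^{*j_2}t_{11}^{*j_1},\qquad i_1j_1=i_2j_2=0,$$ with polynomials $\psi_{i_1i_2j_1j_2}$. Let $\mathrm{Pol}(Y_1\times Y_2)_q=\mathrm{Pol}(Y_1)_q^{\rm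 op}\otimes\mathrm{Pol}(Y_2)_q$, and write $t_{ij}=t_{ij}\otimes1$, $\tau_{ij}=1\otimes t_{ij}$. The space of distributions $D(Y_1\times Y_2)_q'$ is the completion of $\mathrm{Pol}(Y_1\times Y_2)_q$ in the weakest topology for which the tensor products of the functionals $f\mapsto\psi_{i_1i_2j_1j_2}(a)$ are continuous, where $a\in q^{-2\mathbb Z_+}$ for a factor $\widetilde X$ and $a\in q^{2\mathbb Z}$ for a factor $\widetilde\Xi$; that is, it is the space of formal series as above in both factors, with arbitrary functions on the product of the two progressions as coefficients, and with the topology of pointwise convergence of the coefficients. It is a $\mathrm{Pol}(Y_1\times Y_2)_q$-bimodule by continuity. The finite functions $D(Y_1\times Y_2)_q$ are the distributions with only finitely many nonzero coefficient values. Let $\int f\,d\nu=(1-q^2)\sum_{m}\psi_{0000}(q^{-2m})q^{-2m}$ (the sum over $m\in\mathbb Z_+$ for $\widetilde X$, $m\in\mathbb Z$ for $\widetilde\Xi$), and let $\iint f\psi\,d\nu_1d\nu_2$ be the resulting pairing of a distribution $f$ with a finite function $\psi$, extended by continuity from polynomial $f$. A function $f:\mathbb C\setminus\{0\}\to D(Y_1\times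 Y_2)_q'$ is called a polynomial vector-function if for every finite function $\psi$ the function $\lambda\mapsto\iint f(\lambda)\psi\,d\nu_1d\nu_2$ belongs to $\mathbb C[\lambda,\lambda^{-1}]$. Let $k_{11}=t_{11}\tau_{22}-qt_{12}\tau_{21}$. **Proposition.** For each of the three spaces $D(\widetilde X\times\widetilde X)_q'$, $D(\widetilde X\times\widetilde\Xi)_q'$, $D(\widetilde\Xi\times\widetilde X)_q'$ the following holds. The elements $t_{12}$, $\tau_{21}$ and $(-qt_{12}\tau_{21})^l$, $l\in\mathbb Z_+$, act on distributions bijectively by left multiplication. For every $l\in\mathbb Z_+$ there is a unique distribution $k_{11}^{-l}$ with $k_{11}^l\,k_{11}^{-l}=1=k_{11}^{-l}\,k_{11}^l$. There exists a unique polynomial vector-function $f(\lambda)$ such that for all $l\in\mathbb Z_+$ $$k_{11}^{-l}=(-qt_{12}\tau_{21})^{-l}f(q^{2l}).$$ Explicitly, with $z=qt_{12}^{-1}t_{11}$, $\zeta^*=\tau_{21}^{-1}\tau_{22}$ and $(a;q^2)_n=\prod_{j=0}^{n-1}(1-aq^{2j})$, $$f(\lambda)=\sum_{n=0}^\infty\frac{(\lambda;q^2)_n}{(q^2;q^2)_n}(z\zeta^*)^n\qquad(\lambda\in\mathbb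 C\setminus\{0\}),$$ the series being convergent in the space of distributions. -/

import Mathlib

open Filter Topology Polynomial TensorProduct

namespace QSU

/-- The two quantum spaces on which kernels live: the principal homogeneous space `X̃`
and the cone `Ξ̃`. -/
inductive QSpace
  | principal
  | cone

/-- The right-hand side of `t₁₁t₂₂ - q t₁₂t₂₁ = c`: it is `1` for `X̃` and `0` for `Ξ̃`. -/
def QSpace.det : QSpace → ℂ
  | .principal => 1
  | .cone => 0

/-- The deformation parameter, `0 < q < 1`. -/
structure QParam where
  val : ℝ
  pos : 0 < val
  lt_one : val < 1

/-- `q` as a complex number. -/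
noncomputable def QParam.c (q : QParam) : ℂ := (q.val : ℂ)

theorem QParam.c_ne_zero (q : QParam) : q.c ≠ 0 := by
  have := q.pos.ne'
  simpa [QParam.c] using this

/-- The four generators `t_{ij}`. -/
inductive Gen
  | t11
  | t12
  | t21
  | t22

section Pol

local notation "τ" => FreeAlgebra.ι ℂ (X := Gen)

/-- The defining relations of `Pol(X̃)_q` and `Pol(Ξ̃)_q`. -/
inductive Rel (q : QParam) (Y : QSpace) : FreeAlgebra ℂ Gen → FreeAlgebra ℂ Gen → Prop
  | r1 : Rel q Y (τ .t11 * τ .t12) (q.c • (τ .t12 * τ .t11))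
  | r2 : Rel q Y (τ .t21 * τ .t22) (q.c • (τ .t22 * τ .t21))
  | r3 : Rel q Y (τ .t11 * τ .t21) (q.c • (τ .t21 * τ .t11))
  | r4 : Rel q Y (τ .t12 * τ .t22) (q.c • (τ .t22 * τ .t12))
  | r5 : Rel q Y (τ .t12 * τ .t21) (τ .t21 * τ .t12)
  | r6 : Rel q Y (τ .t11 * τ .t22 - τ .t22 * τ .t11) ((q.c - q.c⁻¹) • (τ .t12 * τ .t21))
  | r7 : Rel q Y (τ .t11 * τ .t22 - q.c • (τ .t12 * τ .t21))
      (algebraMap ℂ (FreeAlgebra ℂ Gen) Y.det)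

end Pol

/-- The algebra `Pol(Y)_q`, `Y ∈ {X̃, Ξ̃}`, by generators and relations. -/
def Pol (q : QParam) (Y : QSpace) := RingQuot (Rel q Y)

variable (q : QParam) (Y : QSpace)

noncomputable instance : Ring (Pol q Y) := inferInstanceAs (Ring (RingQuot (Rel q Y)))

noncomputable instance : Algebra ℂ (Pol q Y) :=
  inferInstanceAs (Algebra ℂ (RingQuot (Rel q Y)))

/-- The quotient map from the free algebra. -/
noncomputable def Pol.mk : FreeAlgebra ℂ Gen →ₐ[ℂ] Pol q Y := RingQuot.mkAlgHom ℂ (Rel q Y)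

/-- The generators `t_{ij}` of `Pol(Y)_q`. -/
noncomputable def gen (g : Gen) : Pol q Y := Pol.mk q Y (FreeAlgebra.ι ℂ g)

/-- `t₁₁^* = -t₂₂`. -/
noncomputable def t11s : Pol q Y := -gen q Y .t22

/-- `t₁₂^* = -q t₂₁`. -/
noncomputable def t12s : Pol q Y := -(q.c • gen q Y .t21)

/-- `x = t₁₂ t₁₂^*`. -/
noncomputable def xel : Pol q Y := gen q Y .t12 * t12s q Y

/-- The index set `M'' = {(i₁,i₂,j₁,j₂) ∈ ℤ₊⁴ | i₁j₁ = i₂j₂ = 0}`. -/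
@[ext] structure MIdx where
  i1 : ℕ
  i2 : ℕ
  j1 : ℕ
  j2 : ℕ
  h1 : i1 * j1 = 0
  h2 : i2 * j2 = 0

/-- The index `(0,0,0,0)`. -/
def MIdx.zero : MIdx := ⟨0, 0, 0, 0, rfl, rfl⟩

/-- `ψ ↦ t₁₁^{i₁} t₁₂^{i₂} ψ(x) t₁₂^{*j₂} t₁₁^{*j₁}`. -/
noncomputable def monomialMap (i1 i2 j2 j1 : ℕ) : ℂ[X] →ₗ[ℂ] Pol q Y :=
  LinearMap.mulRight ℂ (t11s q Y ^ j1) ∘ₗ LinearMap.mulRight ℂ (t12s q Y ^ j2) ∘ₗ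
    LinearMap.mulLeft ℂ (gen q Y .t11 ^ i1 * gen q Y .t12 ^ i2) ∘ₗ
    (Polynomial.aeval (xel q Y)).toLinearMap

theorem monomialMap_apply (i1 i2 j2 j1 : ℕ) (P : ℂ[X]) :
    monomialMap q Y i1 i2 j2 j1 P = gen q Y .t11 ^ i1 * gen q Y .t12 ^ i2 *
      Polynomial.aeval (xel q Y) P * t12s q Y ^ j2 * t11s q Y ^ j1 := rfl

/-- `(ψ_i)_{i ∈ M''} ↦ ∑ t₁₁^{i₁} t₁₂^{i₂} ψ_{i₁i₂j₁j₂}(x) t₁₂^{*j₂} t₁₁^{*j₁}`. -/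
noncomputable def normalForm : (MIdx →₀ ℂ[X]) →ₗ[ℂ] Pol q Y :=
  Finsupp.lsum ℂ fun i => monomialMap q Y i.i1 i.i2 i.j2 i.j1

/-! ### Existence and uniqueness of the decomposition -/

section Span

theorem rel_of {a b : FreeAlgebra ℂ Gen} (h : Rel q Y a b) :
    Pol.mk q Y a = Pol.mk q Y b :=
  RingQuot.mkAlgHom_rel ℂ h

theorem e1 : gen q Y .t11 * gen q Y .t12 = q.c • (gen q Y .t12 * gen q Y .t11) := by
  simpa [gen] using rel_of q Y Rel.r1
theorem e2 : gen q Y .t21 * gen q Y .t22 = q.c • (gen q Y .t22 * gen q Y .t21) := by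
  simpa [gen] using rel_of q Y Rel.r2
theorem e3 : gen q Y .t11 * gen q Y .t21 = q.c • (gen q Y .t21 * gen q Y .t11) := by
  simpa [gen] using rel_of q Y Rel.r3
theorem e4 : gen q Y .t12 * gen q Y .t22 = q.c • (gen q Y .t22 * gen q Y .t12) := by
  simpa [gen] using rel_of q Y Rel.r4
theorem e5 : gen q Y .t12 * gen q Y .t21 = gen q Y .t21 * gen q Y .t12 := by
  simpa [gen] using rel_of q Y Rel.r5
theorem e6 : gen q Y .t11 * gen q Y .t22 - gen q Y .t22 * gen q Y .t11 =
    (q.c - q.c⁻¹) • (gen q Y .t12 * gen q Y .t21) := by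
  have h := rel_of q Y Rel.r6
  rw [map_sub, map_smul, map_mul, map_mul, map_mul] at h
  exact h
theorem e7 : gen q Y .t11 * gen q Y .t22 - q.c • (gen q Y .t12 * gen q Y .t21) =
    algebraMap ℂ _ Y.det := by
  have h := rel_of q Y Rel.r7
  rw [map_sub, map_smul, map_mul, map_mul, AlgHom.commutes] at h
  exact h

theorem t12_t11 : gen q Y .t12 * gen q Y .t11 = q.c⁻¹ • (gen q Y .t11 * gen q Y .t12) := by
  rw [e1, smul_smul, inv_mul_cancel₀ q.c_ne_zero, one_smul]

theorem t12s_t11 : t12s q Y * gen q Y .t11 = q.c⁻¹ • (gen q Y .t11 * t12s q Y) := by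
  simp only [t12s, mul_neg, neg_mul, mul_smul_comm, smul_mul_assoc, e3, smul_neg]
  rw [smul_smul q.c⁻¹, inv_mul_cancel₀ q.c_ne_zero, one_smul]

theorem t12s_t12 : t12s q Y * gen q Y .t12 = gen q Y .t12 * t12s q Y := by
  simp only [t12s, mul_neg, neg_mul, mul_smul_comm, smul_mul_assoc, e5]

theorem t11s_t12 : t11s q Y * gen q Y .t12 = q.c⁻¹ • (gen q Y .t12 * t11s q Y) := by
  simp only [t11s, mul_neg, neg_mul, e4, smul_neg]
  rw [smul_smul, inv_mul_cancel₀ q.c_ne_zero, one_smul]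

theorem t11s_t12s : t11s q Y * t12s q Y = q.c⁻¹ • (t12s q Y * t11s q Y) := by
  simp only [t11s, t12s, mul_neg, neg_mul, neg_neg, mul_smul_comm, smul_mul_assoc, e2]
  rw [smul_smul q.c⁻¹, inv_mul_cancel₀ q.c_ne_zero, one_smul, smul_neg, neg_neg]

theorem t11_t11s : gen q Y .t11 * t11s q Y = xel q Y - algebraMap ℂ _ Y.det := by
  rw [← e7]
  simp only [t11s, t12s, xel, mul_neg, mul_smul_comm]
  abel

theorem t11s_t11 : t11s q Y * gen q Y .t11 =
    (q.c⁻¹ ^ 2) • xel q Y - algebraMap ℂ _ Y.det := by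
  have h6 := e6 q Y
  have h : gen q Y .t22 * gen q Y .t11 =
      gen q Y .t11 * gen q Y .t22 - (q.c - q.c⁻¹) • (gen q Y .t12 * gen q Y .t21) := by
    rw [← h6]; abel
  rw [← e7, t11s, neg_mul, h, xel, t12s]
  simp only [mul_neg, mul_smul_comm, smul_neg, smul_smul, sub_smul]
  rw [show q.c⁻¹ ^ 2 * q.c = q.c⁻¹ by
    rw [pow_two, mul_assoc, inv_mul_cancel₀ q.c_ne_zero, mul_one]]
  abel

theorem t11_x : gen q Y .t11 * xel q Y = (q.c ^ 2 • xel q Y) * gen q Y .t11 := by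
  have h := t12s_t11 q Y
  have h' : gen q Y .t11 * t12s q Y = q.c • (t12s q Y * gen q Y .t11) := by
    rw [h, smul_smul, mul_inv_cancel₀ q.c_ne_zero, one_smul]
  rw [xel, ← mul_assoc, e1, smul_mul_assoc, mul_assoc, h', mul_smul_comm, smul_smul,
    smul_mul_assoc, pow_two, mul_assoc]

theorem t11s_x : t11s q Y * xel q Y = (q.c⁻¹ ^ 2 • xel q Y) * t11s q Y := by
  rw [xel, ← mul_assoc, t11s_t12, smul_mul_assoc, mul_assoc, t11s_t12s, mul_smul_comm,
    smul_smul, smul_mul_assoc, pow_two, mul_assoc]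

theorem t12_x : gen q Y .t12 * xel q Y = xel q Y * gen q Y .t12 := by
  rw [xel, mul_assoc, t12s_t12]

theorem t12s_x : t12s q Y * xel q Y = xel q Y * t12s q Y := by
  rw [xel, ← mul_assoc, t12s_t12]

/-- If `a x = (s x) a` then `a P(x) = P(s x) a`. -/
theorem comm_aeval {a : Pol q Y} {s : ℂ} (h : a * xel q Y = (s • xel q Y) * a) (P : ℂ[X]) :
    a * aeval (xel q Y) P = aeval (xel q Y) (P.comp (C s * X)) * a := by
  induction P using Polynomial.induction_on with
  | C r => simp [Algebra.commutes]
  | add f g hf hg => simp [mul_add, add_mul, hf, hg]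
  | monomial n r ih =>
    rw [pow_succ, ← mul_assoc, map_mul, ← mul_assoc, ih, aeval_X, mul_assoc, h, ← mul_assoc]
    congr 1
    simp only [mul_comp, C_comp, pow_comp, X_comp, map_mul, aeval_C, aeval_X, map_pow,
      Algebra.smul_def]

theorem comm_pow {a b : Pol q Y} {s : ℂ} (h : a * b = s • (b * a)) (n : ℕ) :
    a * b ^ n = s ^ n • (b ^ n * a) := by
  induction n with
  | zero => simp
  | succ n ih =>
    rw [pow_succ, ← mul_assoc, ih, smul_mul_assoc, mul_assoc, h, mul_smul_comm, smul_smul,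
      mul_assoc, pow_succ]

/-- The image of the normal form map. -/
noncomputable def nfRange : Submodule ℂ (Pol q Y) := LinearMap.range (normalForm q Y)

theorem mono_mem_of (i1 i2 j2 j1 : ℕ) (h1 : i1 * j1 = 0) (h2 : i2 * j2 = 0) (P : ℂ[X]) :
    monomialMap q Y i1 i2 j2 j1 P ∈ nfRange q Y :=
  ⟨Finsupp.single ⟨i1, i2, j1, j2, h1, h2⟩ P, by simp [normalForm]⟩

theorem mono_red2 (i1 i2 j2 j1 : ℕ) (P : ℂ[X]) :
    monomialMap q Y i1 (i2 + 1) (j2 + 1) j1 P = monomialMap q Y i1 i2 j2 j1 (P * X) := by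
  have hP := comm_aeval q Y (a := gen q Y .t12) (s := 1) (by rw [one_smul, t12_x]) P
  rw [C_1, one_mul, comp_X] at hP
  simp only [monomialMap_apply, pow_succ (gen q Y .t12), pow_succ' (t12s q Y), map_mul, aeval_X]
  simp only [mul_assoc]
  congr 2
  rw [← mul_assoc (gen q Y .t12), hP, xel]
  simp only [mul_assoc]

theorem mono_red1 (i1 i2 j2 j1 : ℕ) (P : ℂ[X]) : ∃ Q : ℂ[X],
    monomialMap q Y (i1 + 1) i2 j2 (j1 + 1) P = monomialMap q Y i1 i2 j2 j1 Q := by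
  have hP := comm_aeval q Y (t11_x q Y) P
  have h12 := comm_pow q Y (e1 q Y) i2
  have h12s := comm_pow q Y (show gen q Y .t11 * t12s q Y = q.c • (t12s q Y * gen q Y .t11) by
    rw [t12s_t11, smul_smul, mul_inv_cancel₀ q.c_ne_zero, one_smul]) j2
  have hx : ∀ R : ℂ[X], t12s q Y ^ j2 * aeval (xel q Y) R =
      aeval (xel q Y) R * t12s q Y ^ j2 := fun R => by
    have hc : Commute (t12s q Y) (xel q Y) := t12s_x q Y
    have := hc.pow_left j2
    induction R using Polynomial.induction_on with
    | C r => simp [Algebra.commutes]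
    | add f g hf hg => simp [mul_add, add_mul, hf, hg]
    | monomial n r ih =>
      rw [pow_succ, ← mul_assoc, map_mul, ← mul_assoc, ih, aeval_X, mul_assoc, mul_assoc]
      congr 1
  refine ⟨C (q.c ^ i2 * q.c ^ j2) * (P.comp (C (q.c ^ 2) * X) * (X - C Y.det)), ?_⟩
  have hQ : aeval (xel q Y) (C (q.c ^ i2 * q.c ^ j2) *
      (P.comp (C (q.c ^ 2) * X) * (X - C Y.det))) = (q.c ^ i2 * q.c ^ j2) •
      (aeval (xel q Y) (P.comp (C (q.c ^ 2) * X)) * (xel q Y - algebraMap ℂ _ Y.det)) := by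
    rw [← smul_eq_C_mul, map_smul, map_mul, map_sub, aeval_X, aeval_C]
  have hx' := hx (X - C Y.det)
  rw [map_sub, aeval_X, aeval_C] at hx'
  have key : gen q Y .t11 * (gen q Y .t12 ^ i2 * (aeval (xel q Y) P * (t12s q Y ^ j2 *
      t11s q Y))) = (q.c ^ i2 * q.c ^ j2) • (gen q Y .t12 ^ i2 * (aeval (xel q Y)
      (P.comp (C (q.c ^ 2) * X)) * ((xel q Y - algebraMap ℂ _ Y.det) * t12s q Y ^ j2))) := by
    rw [← mul_assoc, h12, smul_mul_assoc, mul_assoc, ← mul_assoc (gen q Y .t11) (aeval _ _), hP,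
      mul_assoc (aeval _ _), ← mul_assoc (gen q Y .t11), h12s, smul_mul_assoc, mul_assoc,
      t11_t11s, hx']
    simp only [mul_smul_comm, smul_smul]
  simp only [monomialMap_apply, hQ, pow_succ (gen q Y .t11), pow_succ' (t11s q Y)]
  have key' := congrArg (fun y => gen q Y .t11 ^ i1 * (y * t11s q Y ^ j1)) key
  simp only [mul_assoc, mul_smul_comm, smul_mul_assoc] at key' ⊢
  exact key'

theorem mono_mem (i1 i2 j2 j1 : ℕ) (P : ℂ[X]) :
    monomialMap q Y i1 i2 j2 j1 P ∈ nfRange q Y := by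
  induction i2 generalizing j2 P with
  | succ i2 ih =>
    cases j2 with
    | succ j2 => rw [mono_red2]; exact ih _ _
    | zero =>
      clear ih
      induction i1 generalizing j1 P with
      | zero => exact mono_mem_of q Y _ _ _ _ (by simp) (by simp) P
      | succ i1 ih =>
        cases j1 with
        | zero => exact mono_mem_of q Y _ _ _ _ (by simp) (by simp) P
        | succ j1 => obtain ⟨Q, hQ⟩ := mono_red1 q Y i1 (i2 + 1) 0 j1 P; rw [hQ]; exact ih _ _
  | zero =>
    induction i1 generalizing j1 P with
    | zero => exact mono_mem_of q Y _ _ _ _ (by simp) (by simp) P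
    | succ i1 ih =>
      cases j1 with
      | zero => exact mono_mem_of q Y _ _ _ _ (by simp) (by simp) P
      | succ j1 => obtain ⟨Q, hQ⟩ := mono_red1 q Y i1 0 j2 j1 P; rw [hQ]; exact ih _ _

theorem t11_mono (i1 i2 j2 j1 : ℕ) (P : ℂ[X]) :
    gen q Y .t11 * monomialMap q Y i1 i2 j2 j1 P = monomialMap q Y (i1 + 1) i2 j2 j1 P := by
  simp only [monomialMap_apply, pow_succ' (gen q Y .t11), mul_assoc]

theorem t12_mono (i1 i2 j2 j1 : ℕ) (P : ℂ[X]) :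
    gen q Y .t12 * monomialMap q Y i1 i2 j2 j1 P =
      q.c⁻¹ ^ i1 • monomialMap q Y i1 (i2 + 1) j2 j1 P := by
  simp only [monomialMap_apply, ← mul_assoc, comm_pow q Y (t12_t11 q Y)]
  simp only [pow_succ' (gen q Y .t12), mul_assoc, smul_mul_assoc]

theorem t12s_mono (i1 i2 j2 j1 : ℕ) (P : ℂ[X]) :
    t12s q Y * monomialMap q Y i1 i2 j2 j1 P =
      q.c⁻¹ ^ i1 • monomialMap q Y i1 i2 (j2 + 1) j1 P := by
  have hP := comm_aeval q Y (a := t12s q Y) (s := 1) (by rw [one_smul, t12s_x]) P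
  rw [C_1, one_mul, comp_X] at hP
  have h12 : t12s q Y * gen q Y .t12 ^ i2 = gen q Y .t12 ^ i2 * t12s q Y :=
    Commute.pow_right (t12s_t12 q Y) i2
  simp only [monomialMap_apply, ← mul_assoc, comm_pow q Y (t12s_t11 q Y), smul_mul_assoc]
  congr 1
  rw [mul_assoc _ (t12s q Y) (gen q Y .t12 ^ i2), h12, ← mul_assoc,
    mul_assoc _ (t12s q Y) (aeval _ _), hP]
  simp only [pow_succ' (t12s q Y), mul_assoc]

theorem x_mono (i1 i2 j2 j1 : ℕ) (P : ℂ[X]) :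
    xel q Y * monomialMap q Y i1 i2 j2 j1 P ∈ nfRange q Y := by
  rw [xel, mul_assoc, t12s_mono, mul_smul_comm, t12_mono]
  exact Submodule.smul_mem _ _ (Submodule.smul_mem _ _ (mono_mem q Y _ _ _ _ _))

theorem t11s_mono (i1 i2 j2 j1 : ℕ) (P : ℂ[X]) :
    t11s q Y * monomialMap q Y i1 i2 j2 j1 P ∈ nfRange q Y := by
  cases i1 with
  | succ i1 =>
    rw [← t11_mono, ← mul_assoc, t11s_t11, sub_mul, smul_mul_assoc, ← Algebra.smul_def]
    exact Submodule.sub_mem _ (Submodule.smul_mem _ _ (x_mono q Y _ _ _ _ _))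
      (Submodule.smul_mem _ _ (mono_mem q Y _ _ _ _ _))
  | zero =>
    have hP := comm_aeval q Y (t11s_x q Y) P
    have h : t11s q Y * monomialMap q Y 0 i2 j2 j1 P = (q.c⁻¹ ^ i2 * q.c⁻¹ ^ j2) •
        monomialMap q Y 0 i2 j2 (j1 + 1) (P.comp (C (q.c⁻¹ ^ 2) * X)) := by
      simp only [monomialMap_apply, pow_zero, one_mul, ← mul_assoc,
        comm_pow q Y (t11s_t12 q Y), smul_mul_assoc]
      rw [mul_assoc _ (t11s q Y) (aeval _ _), hP, ← mul_assoc, mul_assoc _ (t11s q Y),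
        comm_pow q Y (t11s_t12s q Y)]
      simp only [pow_succ' (t11s q Y), mul_assoc, smul_smul, mul_smul_comm, smul_mul_assoc]
    rw [h]
    exact Submodule.smul_mem _ _ (mono_mem q Y _ _ _ _ _)

theorem gen_mul_mem (g : Gen) {p : Pol q Y} (hp : p ∈ nfRange q Y) :
    gen q Y g * p ∈ nfRange q Y := by
  obtain ⟨c, rfl⟩ := hp
  induction c using Finsupp.induction_linear with
  | zero => simp
  | add a b ha hb => rw [map_add, mul_add]; exact Submodule.add_mem _ ha hb
  | single i P =>
    rw [show normalForm q Y (Finsupp.single i P) = monomialMap q Y i.i1 i.i2 i.j2 i.j1 P by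
      simp [normalForm]]
    cases g with
    | t11 => rw [t11_mono]; exact mono_mem q Y _ _ _ _ _
    | t12 => rw [t12_mono]; exact Submodule.smul_mem _ _ (mono_mem q Y _ _ _ _ _)
    | t21 =>
      have h : gen q Y .t21 = (-q.c⁻¹) • t12s q Y := by
        rw [t12s, smul_neg, neg_smul, neg_neg, smul_smul, inv_mul_cancel₀ q.c_ne_zero, one_smul]
      rw [h, smul_mul_assoc, t12s_mono]
      exact Submodule.smul_mem _ _ (Submodule.smul_mem _ _ (mono_mem q Y _ _ _ _ _))
    | t22 =>
      have h : gen q Y .t22 = (-1 : ℂ) • t11s q Y := by simp [t11s]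
      rw [h, smul_mul_assoc]
      exact Submodule.smul_mem _ _ (t11s_mono q Y _ _ _ _ _)

theorem normalForm_surjective : Function.Surjective (normalForm q Y) := by
  have main : ∀ a : FreeAlgebra ℂ Gen, ∀ p ∈ nfRange q Y,
      Pol.mk q Y a * p ∈ nfRange q Y := by
    intro a
    induction a using FreeAlgebra.induction with
    | grade0 r =>
      intro p hp
      rw [AlgHom.commutes, ← Algebra.smul_def]
      exact Submodule.smul_mem _ _ hp
    | grade1 g => intro p hp; exact gen_mul_mem q Y g hp
    | mul a b ha hb => intro p hp; rw [map_mul, mul_assoc]; exact ha _ (hb _ hp)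
    | add a b ha hb =>
      intro p hp; rw [map_add, add_mul]; exact Submodule.add_mem _ (ha _ hp) (hb _ hp)
  intro p
  obtain ⟨a, rfl⟩ := RingQuot.mkAlgHom_surjective ℂ (Rel q Y) p
  have h1 : (1 : Pol q Y) ∈ nfRange q Y := by
    have := mono_mem q Y 0 0 0 0 1
    simpa [monomialMap_apply] using this
  have := main a 1 h1
  rwa [mul_one] at this

end Span

section Indep

/-- Auxiliary operators `t_{ij}` on functions on `ℤ × ℤ`. -/
noncomputable def opFun : Gen → Module.End ℂ (ℤ × ℤ → ℂ)
  | .t11 => LinearMap.pi fun a => LinearMap.proj (a.1 - 1, a.2)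
  | .t12 => LinearMap.pi fun a => q.c ^ (-a.1) • LinearMap.proj (a.1, a.2 - 1)
  | .t21 => LinearMap.pi fun a => (-(q.c⁻¹ * q.c ^ (-a.1))) • LinearMap.proj (a.1, a.2 + 1)
  | .t22 => LinearMap.pi fun a =>
      (Y.det - q.c ^ (-(a.1 + 1)) * q.c ^ (-(a.1 + 1))) • LinearMap.proj (a.1 + 1, a.2)

theorem opFun_rel ⦃a b : FreeAlgebra ℂ Gen⦄ (h : Rel q Y a b) :
    FreeAlgebra.lift ℂ (opFun q Y) a = FreeAlgebra.lift ℂ (opFun q Y) b := by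
  have hq := q.c_ne_zero
  have e : ∀ m : ℤ, q.c ^ (-(m - 1)) = q.c * q.c ^ (-m) := fun m => by
    rw [neg_sub, sub_eq_add_neg, zpow_add₀ hq, zpow_one]
  have e' : ∀ m : ℤ, q.c ^ (-(m + 1)) = q.c⁻¹ * q.c ^ (-m) := fun m => by
    rw [neg_add, zpow_add₀ hq, zpow_neg_one, mul_comm]
  cases h <;> refine LinearMap.ext fun g => funext fun ⟨m, p⟩ => ?_ <;>
    simp only [map_mul, map_sub, map_smul, FreeAlgebra.lift_ι_apply, AlgHom.commutes, opFun,
      Module.End.mul_apply, LinearMap.pi_apply, LinearMap.smul_apply, LinearMap.proj_apply,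
      LinearMap.sub_apply, Pi.smul_apply, Pi.sub_apply, smul_eq_mul, e, e',
      Module.algebraMap_end_apply, sub_add_cancel, add_sub_cancel_right] <;>
    generalize q.c ^ (-m) = w <;> field_simp <;> ring

/-- Auxiliary representation of `Pol(Y)_q`. -/
noncomputable def rep : Pol q Y →ₐ[ℂ] Module.End ℂ (ℤ × ℤ → ℂ) :=
  RingQuot.liftAlgHom ℂ ⟨FreeAlgebra.lift ℂ (opFun q Y), opFun_rel q Y⟩

theorem rep_gen (g : Gen) : rep q Y (gen q Y g) = opFun q Y g := by
  unfold rep gen Pol.mk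
  erw [RingQuot.liftAlgHom_mkAlgHom_apply]
  rw [FreeAlgebra.lift_ι_apply]

theorem rep_t11_pow (n : ℕ) (g : ℤ × ℤ → ℂ) (m p : ℤ) :
    rep q Y (gen q Y .t11 ^ n) g (m, p) = g (m - n, p) := by
  induction n generalizing g with
  | zero => simp
  | succ n ih =>
    rw [pow_succ, map_mul, Module.End.mul_apply, ih, rep_gen]
    simp only [opFun, LinearMap.pi_apply, LinearMap.proj_apply]
    congr 2; push_cast; ring

theorem rep_t12_pow (n : ℕ) (g : ℤ × ℤ → ℂ) (m p : ℤ) :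
    rep q Y (gen q Y .t12 ^ n) g (m, p) = (q.c ^ (-m)) ^ n * g (m, p - n) := by
  induction n generalizing g with
  | zero => simp
  | succ n ih =>
    rw [pow_succ, map_mul, Module.End.mul_apply, ih, rep_gen]
    simp only [opFun, LinearMap.pi_apply, LinearMap.smul_apply, LinearMap.proj_apply, smul_eq_mul]
    rw [pow_succ, mul_assoc, show p - (n : ℤ) - 1 = p - ((n + 1 : ℕ) : ℤ) by push_cast; ring]

theorem rep_t12s (g : ℤ × ℤ → ℂ) (m p : ℤ) :
    rep q Y (t12s q Y) g (m, p) = q.c ^ (-m) * g (m, p + 1) := by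
  rw [t12s, map_neg, map_smul, rep_gen]
  simp only [opFun, LinearMap.neg_apply, LinearMap.smul_apply, Pi.neg_apply, Pi.smul_apply,
    LinearMap.pi_apply, LinearMap.proj_apply, smul_eq_mul]
  have := q.c_ne_zero
  field_simp

theorem rep_t12s_pow (n : ℕ) (g : ℤ × ℤ → ℂ) (m p : ℤ) :
    rep q Y (t12s q Y ^ n) g (m, p) = (q.c ^ (-m)) ^ n * g (m, p + n) := by
  induction n generalizing g with
  | zero => simp
  | succ n ih =>
    rw [pow_succ, map_mul, Module.End.mul_apply, ih, rep_t12s, pow_succ, mul_assoc,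
      show p + (n : ℤ) + 1 = p + ((n + 1 : ℕ) : ℤ) by push_cast; ring]

theorem rep_t11s (g : ℤ × ℤ → ℂ) (m p : ℤ) :
    rep q Y (t11s q Y) g (m, p) =
      (q.c ^ (-(m + 1)) * q.c ^ (-(m + 1)) - Y.det) * g (m + 1, p) := by
  rw [t11s, map_neg, rep_gen]
  simp only [opFun, LinearMap.neg_apply, LinearMap.smul_apply, Pi.neg_apply,
    LinearMap.pi_apply, LinearMap.proj_apply, smul_eq_mul]
  ring

theorem rep_t11s_pow (n : ℕ) (g : ℤ × ℤ → ℂ) (m p : ℤ) :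
    rep q Y (t11s q Y ^ n) g (m, p) = (∏ s ∈ Finset.range n,
      (q.c ^ (-(m + s + 1)) * q.c ^ (-(m + s + 1)) - Y.det)) * g (m + n, p) := by
  induction n generalizing g with
  | zero => simp
  | succ n ih =>
    rw [pow_succ, map_mul, Module.End.mul_apply, ih, rep_t11s, Finset.prod_range_succ, mul_assoc,
      show m + (n : ℤ) + 1 = m + ((n + 1 : ℕ) : ℤ) by push_cast; ring]

theorem rep_aeval (P : ℂ[X]) (g : ℤ × ℤ → ℂ) (m p : ℤ) :
    rep q Y (aeval (xel q Y) P) g (m, p) = P.eval (q.c ^ (-m) * q.c ^ (-m)) * g (m, p) := by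
  induction P using Polynomial.induction_on generalizing g with
  | C r => simp
  | add f h hf hh => simp [hf, hh, add_mul]
  | monomial n r ih =>
    have h1 := rep_t12_pow q Y 1
    simp only [pow_one, Nat.cast_one] at h1
    rw [pow_succ, ← mul_assoc, map_mul, map_mul, Module.End.mul_apply, ih, aeval_X, xel, map_mul,
      Module.End.mul_apply, h1, rep_t12s, sub_add_cancel]
    simp only [eval_mul, eval_X]
    ring

theorem rep_monomialMap (i1 i2 j2 j1 : ℕ) (P : ℂ[X]) (g : ℤ × ℤ → ℂ) (m p : ℤ) :
    rep q Y (monomialMap q Y i1 i2 j2 j1 P) g (m + i1, p) =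
      ((q.c ^ (-m)) ^ i2 * (q.c ^ (-m)) ^ j2 * ∏ s ∈ Finset.range j1,
        (q.c ^ (-(m + s + 1)) * q.c ^ (-(m + s + 1)) - Y.det)) *
      P.eval (q.c ^ (-m) * q.c ^ (-m)) * g (m + j1, p - i2 + j2) := by
  rw [monomialMap_apply, map_mul, map_mul, map_mul, map_mul]
  simp only [Module.End.mul_apply]
  rw [rep_t11_pow, add_sub_cancel_right, rep_t12_pow, rep_aeval, rep_t12s_pow, rep_t11s_pow]
  ring

theorem QParam.c_pow_ne_one (n : ℕ) (hn : n ≠ 0) : q.c ^ n ≠ 1 := by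
  intro h
  rw [QParam.c, ← Complex.ofReal_pow, Complex.ofReal_eq_one] at h
  exact (pow_lt_one₀ q.pos.le q.lt_one hn).ne h

theorem normalForm_injective : Function.Injective (normalForm q Y) := by
  rw [injective_iff_map_eq_zero]
  intro ψ hψ
  ext1 i
  by_contra hne
  have hroot : ∀ k : ℕ, (ψ i).eval (q.c ^ (2 * (i.j1 + 1 + k))) = 0 := by
    intro k
    set m : ℤ := -((i.j1 + 1 + k : ℕ) : ℤ) with hm
    set g : ℤ × ℤ → ℂ := Pi.single (m + i.j1, 0) 1 with hg
    have h0 : rep q Y (normalForm q Y ψ) g (m + i.i1, i.i2 - i.j2) = 0 := by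
      rw [hψ, map_zero]; rfl
    rw [normalForm, Finsupp.lsum_apply, Finsupp.sum, map_sum, LinearMap.sum_apply,
      Finset.sum_apply, Finset.sum_eq_single i] at h0
    · rw [rep_monomialMap, hg, show ((i.i2 : ℤ) - i.j2 - i.i2 + i.j2) = 0 by ring,
        Pi.single_eq_same, mul_one] at h0
      have hw : q.c ^ (-m) = q.c ^ (i.j1 + 1 + k) := by rw [hm, neg_neg, zpow_natCast]
      rcases mul_eq_zero.1 h0 with h | h
      · exfalso
        rcases mul_eq_zero.1 h with h | h
        · rw [hw] at h
          exact mul_ne_zero (pow_ne_zero _ (pow_ne_zero _ q.c_ne_zero))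
            (pow_ne_zero _ (pow_ne_zero _ q.c_ne_zero)) h
        · obtain ⟨s, hs, h⟩ := Finset.prod_eq_zero_iff.1 h
          have hs := Finset.mem_range.1 hs
          have hw' : q.c ^ (-(m + s + 1)) = q.c ^ (i.j1 + k - s) := by
            rw [← zpow_natCast, hm, Nat.cast_sub (show s ≤ i.j1 + k by omega)]
            congr 1
            push_cast
            ring
          rw [hw', ← pow_add] at h
          cases Y with
          | principal => exact q.c_pow_ne_one _ (by omega) (sub_eq_zero.1 h)
          | cone => exact pow_ne_zero _ q.c_ne_zero ((sub_eq_zero.1 h).trans rfl)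
      · rw [hw, ← pow_add, ← two_mul] at h
        exact h
    · intro b _ hb
      rw [show m + (i.i1 : ℤ) = (m + i.i1 - b.i1) + b.i1 by ring, rep_monomialMap, hg,
        Pi.single_eq_of_ne, mul_zero]
      intro h
      apply hb
      have ha := congrArg Prod.fst h
      have hb := congrArg Prod.snd h
      simp only at ha hb
      have h1 := i.h1; have h2 := i.h2; have h1' := b.h1; have h2' := b.h2
      rw [Nat.mul_eq_zero] at h1 h2 h1' h2'
      ext <;> omega
    · intro h
      rw [Finsupp.notMem_support_iff.1 h]; simp
  refine hne (Polynomial.eq_zero_of_infinite_isRoot _ ?_)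
  refine Set.infinite_of_injective_forall_mem (f := fun k : ℕ => q.c ^ (2 * (i.j1 + 1 + k)))
    ?_ hroot
  intro a b hab
  simp only [QParam.c, ← Complex.ofReal_pow, Complex.ofReal_inj] at hab
  have := (pow_right_injective₀ q.pos q.lt_one.ne) hab
  omega

end Indep

/-- Every `f ∈ Pol(Y)_q` has a unique decomposition
`f = ∑_{i ∈ M''} t₁₁^{i₁} t₁₂^{i₂} ψ_i(x) t₁₂^{*j₂} t₁₁^{*j₁}`; this is the bijection. -/
noncomputable def normalFormEquiv : (MIdx →₀ ℂ[X]) ≃ₗ[ℂ] Pol q Y :=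
  LinearEquiv.ofBijective (normalForm q Y) ⟨normalForm_injective q Y, normalForm_surjective q Y⟩

/-! ### Distributions -/

/-- Labels `m` of the points `q^{-2m}` of the spectrum of `x`: `m ∈ ℤ₊` for `X̃` (the
progression `q^{-2ℤ₊}`), `m ∈ ℤ` for `Ξ̃` (the progression `q^{2ℤ}`). -/
abbrev QSpace.Spec (Y : QSpace) := {m : ℤ // Y = .principal → 0 ≤ m}

/-- The functionals `f ↦ ψ_i(q^{-2m})`, `i ∈ M''`, on `Pol(Y)_q`. -/
noncomputable def coefVal : Pol q Y →ₗ[ℂ] (MIdx × Y.Spec → ℂ) :=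
  LinearMap.pi fun a => Polynomial.leval (q.c ^ (-2 * (a.2 : ℤ))) ∘ₗ Finsupp.lapply a.1 ∘ₗ
    (normalFormEquiv q Y).symm.toLinearMap

variable (Y₁ Y₂ : QSpace)

/-- `Pol(Y₁ × Y₂)_q = Pol(Y₁)_q^{op} ⊗ Pol(Y₂)_q`. -/
abbrev PolProd := (Pol q Y₁)ᵐᵒᵖ ⊗[ℂ] Pol q Y₂

/-- The space `D(Y₁ × Y₂)_q'` of distributions: formal series in the monomials labelled by
`M'' × M''` whose coefficients are arbitrary functions on the product of the two progressions,
with the topology of pointwise convergence of the coefficients. (It is the completion of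
`Pol(Y₁ × Y₂)_q` along the map `toDist` below.) -/
abbrev Dist (Y₁ Y₂ : QSpace) := (MIdx × Y₁.Spec) × (MIdx × Y₂.Spec) → ℂ

/-- The embedding `Pol(Y₁ × Y₂)_q → D(Y₁ × Y₂)_q'` taking the coefficients:
`f₁ ⊗ f₂ ↦ ψ_{i'}(f₁)(q^{-2m'}) ψ_{i''}(f₂)(q^{-2m''})`. -/
noncomputable def toDist : PolProd q Y₁ Y₂ →ₗ[ℂ] Dist Y₁ Y₂ :=
  LinearMap.pi fun ab => LinearMap.mul' ℂ ℂ ∘ₗ TensorProduct.map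
    (LinearMap.proj ab.1 ∘ₗ coefVal q Y₁ ∘ₗ (MulOpposite.opLinearEquiv ℂ).symm.toLinearMap)
    (LinearMap.proj ab.2 ∘ₗ coefVal q Y₂)

variable {Y₁ Y₂}

/-- The left action `g ↦ K g` of `K ∈ Pol(Y₁ × Y₂)_q` on distributions: the extension by
continuity of the left multiplication by `K` in `Pol(Y₁ × Y₂)_q`. -/
noncomputable def leftMul (K : PolProd q Y₁ Y₂) (g : Dist Y₁ Y₂) : Dist Y₁ Y₂ :=
  limUnder (comap (toDist q Y₁ Y₂) (𝓝 g)) fun p => toDist q Y₁ Y₂ (K * p)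

/-- The right action `g ↦ g K` of `K ∈ Pol(Y₁ × Y₂)_q` on distributions: the extension by
continuity of the right multiplication by `K` in `Pol(Y₁ × Y₂)_q`. -/
noncomputable def rightMul (K : PolProd q Y₁ Y₂) (g : Dist Y₁ Y₂) : Dist Y₁ Y₂ :=
  limUnder (comap (toDist q Y₁ Y₂) (𝓝 g)) fun p => toDist q Y₁ Y₂ (p * K)

/-- The finite functions `D(Y₁ × Y₂)_q` among the distributions. -/
def IsFiniteFunction (ψ : Dist Y₁ Y₂) : Prop := (Function.support ψ).Finite

/-- The integral `∫∫ ψ dν₁ dν₂` of a finite function `ψ`, where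
`∫ f dν = (1 - q²) ∑_m ψ_{0000}(q^{-2m}) q^{-2m}`. -/
noncomputable def integral (ψ : Dist Y₁ Y₂) : ℂ :=
  (1 - q.c ^ 2) ^ 2 * ∑ᶠ m : Y₁.Spec × Y₂.Spec,
    ψ ((MIdx.zero, m.1), (MIdx.zero, m.2)) * q.c ^ (-2 * (m.1 : ℤ)) * q.c ^ (-2 * (m.2 : ℤ))

/-- The pairing `∫∫ f ψ dν₁ dν₂` of a distribution `f` with a finite function `ψ`: the
extension by continuity from polynomials `f`, for which `f ψ` is a finite function. -/
noncomputable def pairing (f ψ : Dist Y₁ Y₂) : ℂ :=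
  limUnder (comap (toDist q Y₁ Y₂) (𝓝 f)) fun p => integral q (leftMul q p ψ)

/-- Polynomial vector-functions `f(λ)`, `λ ∈ ℂ ∖ {0}`: for each finite function `ψ` the integral
`∫∫ f(λ) ψ dν₁ dν₂` is given by an element of `ℂ[λ, λ⁻¹]`. -/
def IsPolynomialVF (f : ℂˣ → Dist Y₁ Y₂) : Prop :=
  ∀ ψ : Dist Y₁ Y₂, IsFiniteFunction ψ →
    ∃ P : LaurentPolynomial ℂ, ∀ lam : ℂˣ, pairing q (f lam) ψ = P.smeval lam

/-! ### The kernels -/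

variable (Y₁ Y₂)

/-- `t_{ij} = t_{ij} ⊗ 1`. -/
noncomputable def t (g : Gen) : PolProd q Y₁ Y₂ := MulOpposite.op (gen q Y₁ g) ⊗ₜ[ℂ] 1

/-- `τ_{ij} = 1 ⊗ t_{ij}`. -/
noncomputable def tau (g : Gen) : PolProd q Y₁ Y₂ := 1 ⊗ₜ[ℂ] gen q Y₂ g

/-- `k₁₁ = t₁₁τ₂₂ - q t₁₂τ₂₁`. -/
noncomputable def k11 : PolProd q Y₁ Y₂ :=
  t q Y₁ Y₂ .t11 * tau q Y₁ Y₂ .t22 - q.c • (t q Y₁ Y₂ .t12 * tau q Y₁ Y₂ .t21)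

/-- `-q t₁₂τ₂₁`. -/
noncomputable def lead : PolProd q Y₁ Y₂ := -(q.c • (t q Y₁ Y₂ .t12 * tau q Y₁ Y₂ .t21))

/-- The distribution `1`. -/
noncomputable def one : Dist Y₁ Y₂ := toDist q Y₁ Y₂ 1

variable {Y₁ Y₂}

/-- `g` is a two-sided inverse of `K` in the bimodule of distributions: `K g = 1 = g K`. -/
def IsInverse (K : PolProd q Y₁ Y₂) (g : Dist Y₁ Y₂) : Prop :=
  leftMul q K g = one q Y₁ Y₂ ∧ rightMul q K g = one q Y₁ Y₂

/-- `K⁻¹ g`, for `K` acting bijectively from the left on distributions. -/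
noncomputable def leftDiv (K : PolProd q Y₁ Y₂) (g : Dist Y₁ Y₂) : Dist Y₁ Y₂ :=
  Function.invFun (leftMul q K) g

/-- `g ↦ z g` with `z = q t₁₂⁻¹ t₁₁`. -/
noncomputable def zMul (g : Dist Y₁ Y₂) : Dist Y₁ Y₂ :=
  q.c • leftDiv q (t q Y₁ Y₂ .t12) (leftMul q (t q Y₁ Y₂ .t11) g)

/-- `g ↦ ζ^* g` with `ζ^* = τ₂₁⁻¹ τ₂₂`. -/
noncomputable def zetaStarMul (g : Dist Y₁ Y₂) : Dist Y₁ Y₂ :=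
  leftDiv q (tau q Y₁ Y₂ .t21) (leftMul q (tau q Y₁ Y₂ .t22) g)

variable (Y₁ Y₂) in
/-- The distribution `(z ζ^*)^n`. -/
noncomputable def zZetaPow (n : ℕ) : Dist Y₁ Y₂ :=
  (fun g => zMul q (zetaStarMul q g))^[n] (one q Y₁ Y₂)

/-- `(a; q²)_n = ∏_{j<n} (1 - a q^{2j})`. -/
noncomputable def qPoch (a : ℂ) (n : ℕ) : ℂ := ∏ j ∈ Finset.range n, (1 - a * q.c ^ (2 * j))

/-- The point `λ = q^{2l}`. -/
noncomputable def qPt (l : ℕ) : ℂˣ := Units.mk0 q.c q.c_ne_zero ^ (2 * l)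

end QSU

/-
Every generator acts on distributions, from the left and from the right, as a weighted shift of the
entries of the matrices that represent `Pol(Y₁)_q` and `Pol(Y₂)_q`. Write `k₁₁ = B + t₁₁ τ₂₂` with
`B = -q t₁₂ τ₂₁`, and `w = z ζ^*`. The operator `B` is invertible, since it is a shift with nonzero
weights that preserves the set of positions, and `k₁₁ = B (1 - q⁻² w)`, `w B = q⁻² B w`. The
recurrence of the `q`-binomial coefficients then gives `f(λ q²) k₁₁ = B f(λ)`, hence
`f(q^{2l}) k₁₁^l = B^l`, so that `B^{-l} f(q^{2l})` is a left inverse of `k₁₁^l`. It is the only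
one, and a right inverse too, because right multiplication by `k₁₁` is injective: one of its two
terms is invertible, and relative to it the other lowers a row or a column number, which is bounded
below on the principal homogeneous space. Finally the pairing is a nondegenerate trace form, so a
polynomial vector-function is a family of Laurent polynomials and is determined by its values at
the infinitely many points `q^{2l}`.
-/

namespace QSU

theorem QParam.c_zpow_eq_one_iff (q : QParam) {n : ℤ} : q.c ^ n = 1 ↔ n = 0 := by
  refine ⟨fun h => ?_, fun h => by rw [h, zpow_zero]⟩
  by_contra hn
  obtain ⟨k, rfl | rfl⟩ := n.eq_nat_or_neg
  · exact q.c_pow_ne_one k (by lia) (by rwa [zpow_natCast] at h)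
  · exact q.c_pow_ne_one k (by lia) (by rwa [zpow_neg, zpow_natCast, inv_eq_one] at h)

section MatrixEntries

variable (q : QParam) (Y : QSpace)

theorem adjoin_range_gen : Algebra.adjoin ℂ (Set.range (gen q Y)) = ⊤ := by
  rw [show gen q Y = Pol.mk q Y ∘ FreeAlgebra.ι ℂ from rfl, Set.range_comp, ← AlgHom.map_adjoin,
    FreeAlgebra.adjoin_range_ι, Algebra.map_top, AlgHom.range_eq_top]
  exact RingQuot.mkAlgHom_surjective ℂ (Rel q Y)

/-- Translation by `e` in the second label of the space on which `rep` acts. -/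
def translate (e : ℤ) : Module.End ℂ (ℤ × ℤ → ℂ) :=
  LinearMap.funLeft ℂ ℂ fun y => (y.1, y.2 - e)

theorem commute_rep_translate (f : Pol q Y) (e : ℤ) : Commute (rep q Y f) (translate e) := by
  have hf : f ∈ Algebra.adjoin ℂ (Set.range (gen q Y)) := adjoin_range_gen q Y ▸ Algebra.mem_top
  induction hf using Algebra.adjoin_induction with
  | mem f hf =>
    obtain ⟨g, rfl⟩ := hf
    refine LinearMap.ext fun φ => funext fun y => ?_
    cases g <;> simp [rep_gen, opFun, translate, LinearMap.funLeft, sub_right_comm,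
      add_sub_right_comm]
  | algebraMap r => rw [AlgHom.commutes]; exact Algebra.commutes r _
  | add f f' _ _ h h' => rw [map_add]; exact h.add_left h'
  | mul f f' _ _ h h' => rw [map_mul]; exact h.mul_left h'

/-- The matrix of an element of `Pol(Y)_q` in the representation `rep`: the entry at `(a, b, d)`
is the one in row `a` and column `b` of the first label that raises the second label by `d`. -/
noncomputable def matrixEntry : Pol q Y →ₗ[ℂ] (ℤ × ℤ × ℤ → ℂ) :=
  LinearMap.pi fun x => LinearMap.proj (x.1, x.2.2) ∘ₗ
    LinearMap.applyₗ (Pi.single (x.2.1, 0) 1) ∘ₗ (rep q Y).toLinearMap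

theorem matrixEntry_apply (f : Pol q Y) (x : ℤ × ℤ × ℤ) :
    matrixEntry q Y f x = rep q Y f (Pi.single (x.2.1, 0) 1) (x.1, x.2.2) := rfl

theorem rep_single (f : Pol q Y) (b e a p : ℤ) :
    rep q Y f (Pi.single (b, e) 1) (a, p) = matrixEntry q Y f (a, b, p - e) := by
  have hsingle : translate e (Pi.single (b, 0) 1) = Pi.single (b, e) 1 := by
    funext y
    simp only [translate, LinearMap.funLeft_apply, Pi.single_apply, Prod.ext_iff, sub_eq_zero]
  rw [← hsingle, ← Module.End.mul_apply, commute_rep_translate q Y f e]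
  rfl

/-- The scalar by which left multiplication by `t_{ij}` multiplies the rows of matrices. -/
noncomputable def rowCoeff (g : Gen) (x : ℤ × ℤ × ℤ) : ℂ :=
  match g with
  | .t11 => 1
  | .t12 => q.c ^ (-x.1)
  | .t21 => -(q.c⁻¹ * q.c ^ (-x.1))
  | .t22 => Y.det - q.c ^ (-(x.1 + 1)) * q.c ^ (-(x.1 + 1))

/-- The translation by which left multiplication by `t_{ij}` moves the rows of matrices. -/
def rowShift : Gen → ℤ × ℤ × ℤ
  | .t11 => (-1, 0, 0)
  | .t12 => (0, 0, -1)
  | .t21 => (0, 0, 1)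
  | .t22 => (1, 0, 0)

/-- The scalar by which right multiplication by `t_{ij}` multiplies the columns of matrices. -/
noncomputable def colCoeff (g : Gen) (x : ℤ × ℤ × ℤ) : ℂ :=
  match g with
  | .t11 => 1
  | .t12 => q.c ^ (-x.2.1)
  | .t21 => -(q.c⁻¹ * q.c ^ (-x.2.1))
  | .t22 => Y.det - q.c ^ (-x.2.1) * q.c ^ (-x.2.1)

/-- The translation by which right multiplication by `t_{ij}` moves the columns of matrices. -/
def colShift : Gen → ℤ × ℤ × ℤ
  | .t11 => (0, 1, 0)
  | .t12 => (0, 0, -1)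
  | .t21 => (0, 0, 1)
  | .t22 => (0, -1, 0)

theorem matrixEntry_gen_mul (g : Gen) (f : Pol q Y) (x : ℤ × ℤ × ℤ) :
    matrixEntry q Y (gen q Y g * f) x =
      rowCoeff q Y g x * matrixEntry q Y f (x + rowShift g) := by
  obtain ⟨a, b, d⟩ := x
  simp only [matrixEntry_apply, map_mul, Module.End.mul_apply, rep_gen]
  cases g <;> simp [opFun, rowCoeff, rowShift, sub_eq_add_neg]

theorem opFun_single (g : Gen) (x : ℤ × ℤ × ℤ) :
    opFun q Y g (Pi.single (x.2.1, 0) 1) =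
      colCoeff q Y g x • Pi.single (x.2.1 + (colShift g).2.1, -(colShift g).2.2) 1 := by
  obtain ⟨a, b, d⟩ := x
  funext ⟨m, p⟩
  cases g <;>
    simp only [opFun, colCoeff, colShift, LinearMap.pi_apply, LinearMap.proj_apply,
      LinearMap.smul_apply, Pi.smul_apply, smul_eq_mul, Pi.single_apply, Prod.mk.injEq,
      mul_ite, mul_one, mul_zero] <;>
    grind

theorem matrixEntry_mul_gen (g : Gen) (f : Pol q Y) (x : ℤ × ℤ × ℤ) :
    matrixEntry q Y (f * gen q Y g) x =
      colCoeff q Y g x * matrixEntry q Y f (x + colShift g) := by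
  rw [matrixEntry_apply, map_mul, Module.End.mul_apply, rep_gen, opFun_single, map_smul,
    Pi.smul_apply, rep_single, smul_eq_mul]
  congr 2
  obtain ⟨a, b, d⟩ := x
  cases g <;> simp [colShift, sub_eq_add_neg]

/-- The matrix position of the coefficient `ψ_i(q^{-2m})`, as a bijection. -/
def matrixPosition : MIdx × ℤ ≃ ℤ × ℤ × ℤ where
  toFun u := (u.2 + u.1.i1, u.2 + u.1.j1, u.1.i2 - u.1.j2)
  invFun x := (⟨(x.1 - x.2.1).toNat, x.2.2.toNat, (x.2.1 - x.1).toNat, (-x.2.2).toNat,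
    by rw [Nat.mul_eq_zero]; lia, by rw [Nat.mul_eq_zero]; lia⟩, min x.1 x.2.1)
  left_inv := by
    rintro ⟨⟨i1, i2, j1, j2, h1, h2⟩, m⟩
    rw [Nat.mul_eq_zero] at h1 h2
    simp only [Prod.mk.injEq, MIdx.mk.injEq]
    lia
  right_inv x := by
    simp only [Prod.ext_iff]
    lia

/-- The ratio of a matrix entry and the corresponding coefficient `ψ_i(q^{-2m})`. -/
noncomputable def entryRatio (u : MIdx × ℤ) : ℂ :=
  (q.c ^ (-u.2)) ^ u.1.i2 * (q.c ^ (-u.2)) ^ u.1.j2 * ∏ s ∈ Finset.range u.1.j1,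
    (q.c ^ (-(u.2 + s + 1)) * q.c ^ (-(u.2 + s + 1)) - Y.det)

theorem matrixEntry_monomialMap (i : MIdx) (P : ℂ[X]) (u : MIdx × ℤ) :
    matrixEntry q Y (monomialMap q Y i.i1 i.i2 i.j2 i.j1 P) (matrixPosition u) =
      entryRatio q Y u * (Finsupp.single i P u.1).eval (q.c ^ (-2 * u.2)) := by
  obtain ⟨j, m⟩ := u
  have hrow : m + (j.i1 : ℤ) = m + j.i1 - i.i1 + i.i1 := by ring
  simp only [matrixEntry_apply, matrixPosition, Equiv.coe_fn_mk]
  rw [hrow, rep_monomialMap]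
  by_cases hij : i = j
  · subst hij
    have hcol : (i.i2 : ℤ) - i.j2 - i.i2 + i.j2 = 0 := by ring
    rw [add_sub_cancel_right, hcol, Pi.single_eq_same, mul_one, ← zpow_add₀ q.c_ne_zero,
      ← two_mul, mul_neg, ← neg_mul, Finsupp.single_eq_same]
    rfl
  · rw [Pi.single_eq_of_ne, Finsupp.single_eq_of_ne' hij, mul_zero, eval_zero, mul_zero]
    have h1 := i.h1; have h2 := i.h2; have h1' := j.h1; have h2' := j.h2
    rw [Nat.mul_eq_zero] at h1 h2 h1' h2'
    rw [MIdx.ext_iff] at hij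
    simp only [ne_eq, Prod.mk.injEq]
    lia

theorem matrixEntry_normalForm (ψ : MIdx →₀ ℂ[X]) (u : MIdx × ℤ) :
    matrixEntry q Y (normalForm q Y ψ) (matrixPosition u) =
      entryRatio q Y u * (ψ u.1).eval (q.c ^ (-2 * u.2)) := by
  induction ψ using Finsupp.induction_linear with
  | zero => simp
  | add ψ φ hψ hφ => simp only [map_add, Pi.add_apply, hψ, hφ, Finsupp.add_apply, eval_add, mul_add]
  | single i P =>
    rw [show normalForm q Y (Finsupp.single i P) = monomialMap q Y i.i1 i.i2 i.j2 i.j1 P by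
      simp [normalForm], matrixEntry_monomialMap]

theorem coefVal_normalForm (ψ : MIdx →₀ ℂ[X]) (u : MIdx × Y.Spec) :
    coefVal q Y (normalForm q Y ψ) u = (ψ u.1).eval (q.c ^ (-2 * (u.2 : ℤ))) := by
  have : (normalFormEquiv q Y).symm (normalForm q Y ψ) = ψ :=
    (normalFormEquiv q Y).symm_apply_apply ψ
  simp only [coefVal, LinearMap.pi_apply, LinearMap.comp_apply, LinearEquiv.coe_coe, this,
    Finsupp.lapply_apply, Polynomial.leval_apply]

variable {Y} in
/-- The matrix position of the coefficient labelled by a monomial and a point of the spectrum. -/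
def specPosition (u : MIdx × Y.Spec) : ℤ × ℤ × ℤ := matrixPosition (u.1, u.2)

/-- The matrix positions over the spectrum of `x`. -/
def specPositions : Set (ℤ × ℤ × ℤ) := {x | Y = .principal → 0 ≤ x.1 ∧ 0 ≤ x.2.1}

theorem mem_specPositions_principal {x : ℤ × ℤ × ℤ} :
    x ∈ specPositions .principal ↔ 0 ≤ x.1 ∧ 0 ≤ x.2.1 :=
  forall_prop_of_true rfl

theorem specPositions_cone : specPositions .cone = Set.univ :=
  Set.eq_univ_of_forall fun _ h => nomatch h

theorem specPosition_injective : Function.Injective (specPosition (Y := Y)) :=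
  matrixPosition.injective.comp (Function.injective_id.prodMap Subtype.val_injective)

theorem range_specPosition : Set.range (specPosition (Y := Y)) = specPositions Y := by
  refine Set.Subset.antisymm (Set.range_subset_iff.2 fun u hY => ?_) fun x hx => ?_
  · have := u.2.2 hY
    simp only [specPosition, matrixPosition, Equiv.coe_fn_mk]
    lia
  · refine ⟨((matrixPosition.symm x).1, ⟨(matrixPosition.symm x).2, fun hY => ?_⟩),
      matrixPosition.apply_symm_apply x⟩
    have := hx hY
    simp only [matrixPosition, Equiv.coe_fn_symm_mk]
    lia

theorem matrixEntry_specPosition (f : Pol q Y) (u : MIdx × Y.Spec) :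
    matrixEntry q Y f (specPosition u) = entryRatio q Y (u.1, u.2) * coefVal q Y f u := by
  obtain ⟨ψ, rfl⟩ := normalForm_surjective q Y f
  rw [specPosition, matrixEntry_normalForm, coefVal_normalForm]

theorem entryRatio_ne_zero (u : MIdx × Y.Spec) : entryRatio q Y (u.1, u.2) ≠ 0 := by
  have hq := q.c_ne_zero
  refine mul_ne_zero (mul_ne_zero (pow_ne_zero _ (zpow_ne_zero _ hq))
    (pow_ne_zero _ (zpow_ne_zero _ hq))) (Finset.prod_ne_zero_iff.2 fun s _ => ?_)
  rw [← zpow_add₀ hq]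
  have hm := u.2.2
  cases Y with
  | principal =>
    refine sub_ne_zero.2 (q.c_zpow_eq_one_iff.not.2 ?_)
    have := hm rfl
    lia
  | cone => simpa [QSpace.det] using zpow_ne_zero _ hq

theorem matrixEntry_principal_eq_zero (f : Pol q .principal) {a b d : ℤ} (ha : a < 0)
    (hb : 0 ≤ b) : matrixEntry q .principal f (a, b, d) = 0 := by
  obtain ⟨ψ, rfl⟩ := normalForm_surjective q .principal f
  obtain ⟨⟨i, m⟩, hx⟩ := matrixPosition.surjective (a, b, d)
  have hx' : m + (i.i1 : ℤ) = a ∧ m + (i.j1 : ℤ) = b := by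
    simpa [matrixPosition] using And.intro (congrArg Prod.fst hx) (congrArg (·.2.1) hx)
  rw [← hx, matrixEntry_normalForm, entryRatio,
    Finset.prod_eq_zero (i := (-m - 1).toNat) (Finset.mem_range.2 (by lia)), mul_zero, zero_mul]
  have hm : m + ((-m - 1).toNat : ℤ) + 1 = 0 := by lia
  rw [hm, neg_zero, zpow_zero, mul_one]
  exact sub_self 1

/-- The part of the matrix of an element of `Pol(Y)_q` over the spectrum of `x`. -/
noncomputable def specMatrix (f : Pol q Y) : ℤ × ℤ × ℤ → ℂ :=
  (specPositions Y).indicator (matrixEntry q Y f)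

variable {Y} in
/-- The operator `T` on `Pol(Y)_q` acts on the matrices over the spectrum of `x` as the weighted
shift with weight `c` and translation `v`. -/
def IsMatrixShift (T : Pol q Y → Pol q Y) (c : ℤ × ℤ × ℤ → ℂ) (v : ℤ × ℤ × ℤ) : Prop :=
  ∀ f, ∀ x ∈ specPositions Y, specMatrix q Y (T f) x = c x * specMatrix q Y f (x + v)

variable {q Y} in
theorem IsMatrixShift.of_matrixEntry {T : Pol q Y → Pol q Y} {c : ℤ × ℤ × ℤ → ℂ} {v : ℤ × ℤ × ℤ}
    (h : ∀ f x, matrixEntry q Y (T f) x = c x * matrixEntry q Y f (x + v))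
    (h0 : ∀ f, ∀ x ∈ specPositions Y, x + v ∉ specPositions Y →
      c x * matrixEntry q Y f (x + v) = 0) : IsMatrixShift q T c v := by
  intro f x hx
  rw [specMatrix, specMatrix, Set.indicator_of_mem hx, h]
  by_cases hv : x + v ∈ specPositions Y
  · rw [Set.indicator_of_mem hv]
  · rw [Set.indicator_of_notMem hv, h0 f x hx hv, mul_zero]

theorem isMatrixShift_gen_mul (g : Gen) :
    IsMatrixShift q (gen q Y g * ·) (rowCoeff q Y g) (rowShift g) := by
  refine .of_matrixEntry (matrixEntry_gen_mul q Y g) fun f ⟨a, b, d⟩ hx hv => ?_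
  cases Y with
  | cone => simp only [specPositions_cone, Set.mem_univ, not_true_eq_false] at hv
  | principal =>
    rw [mem_specPositions_principal] at hx hv
    rw [show (a, b, d) + rowShift g = (a + (rowShift g).1, b, d + (rowShift g).2.2) by
      cases g <;> simp [rowShift], matrixEntry_principal_eq_zero q f _ hx.2, mul_zero]
    simp only [Prod.fst_add, Prod.snd_add] at hv
    cases g <;> simp only [rowShift] at hv ⊢ <;> lia

theorem isMatrixShift_mul_gen (g : Gen) :
    IsMatrixShift q (· * gen q Y g) (colCoeff q Y g) (colShift g) := by
  refine .of_matrixEntry (matrixEntry_mul_gen q Y g) fun f ⟨a, b, d⟩ hx hv => ?_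
  cases Y with
  | cone => simp only [specPositions_cone, Set.mem_univ, not_true_eq_false] at hv
  | principal =>
    simp only [mem_specPositions_principal, Prod.fst_add, Prod.snd_add] at hx hv
    cases g with
    | t22 =>
      obtain rfl : b = 0 := by simp only [colShift] at hv; lia
      simp [colCoeff, QSpace.det]
    | _ => simp only [colShift] at hv; lia

end MatrixEntries

section Entries

/-- Positions in pairs of matrices, one for each of the two factors. -/
abbrev Position := (ℤ × ℤ × ℤ) × (ℤ × ℤ × ℤ)

variable {Y₁ Y₂ : QSpace}

/-- The position of a coefficient of a distribution in the pair of matrices. -/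
def position : (MIdx × Y₁.Spec) × (MIdx × Y₂.Spec) → Position :=
  Prod.map specPosition specPosition

theorem position_injective : Function.Injective (position (Y₁ := Y₁) (Y₂ := Y₂)) :=
  (specPosition_injective Y₁).prodMap (specPosition_injective Y₂)

variable (Y₁ Y₂) in
/-- The positions over the spectra of the two factors. -/
abbrev specPairs : Set Position := specPositions Y₁ ×ˢ specPositions Y₂

variable (Y₁ Y₂) in
theorem range_position :
    Set.range (position (Y₁ := Y₁) (Y₂ := Y₂)) = specPairs Y₁ Y₂ := by
  rw [position, Set.range_prodMap, range_specPosition, range_specPosition]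

theorem position_mem (u : (MIdx × Y₁.Spec) × (MIdx × Y₂.Spec)) :
    position u ∈ specPairs Y₁ Y₂ :=
  range_position Y₁ Y₂ ▸ Set.mem_range_self u

variable (q : QParam)

/-- The ratio of a matrix entry and the corresponding coefficient of a distribution. -/
noncomputable def weight (u : (MIdx × Y₁.Spec) × (MIdx × Y₂.Spec)) : ℂ :=
  entryRatio q Y₁ (u.1.1, u.1.2) * entryRatio q Y₂ (u.2.1, u.2.2)

theorem weight_ne_zero (u : (MIdx × Y₁.Spec) × (MIdx × Y₂.Spec)) : weight q u ≠ 0 :=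
  mul_ne_zero (entryRatio_ne_zero q Y₁ u.1) (entryRatio_ne_zero q Y₂ u.2)

/-- The matrix entries of a distribution, extended by zero outside of the spectrum. -/
noncomputable def entry : Dist Y₁ Y₂ →L[ℂ] (Position → ℂ) where
  toFun F := Function.extend position (weight q * F) 0
  map_add' F G := by rw [mul_add, ← Function.extend_add, add_zero]
  map_smul' c F := by
    have := Function.extend_smul c position (weight q * F) (0 : Position → ℂ)
    rwa [smul_zero (A := Position → ℂ), ← mul_smul_comm] at this
  cont := by
    refine continuous_pi fun x => ?_
    by_cases hx : ∃ u : (MIdx × Y₁.Spec) × (MIdx × Y₂.Spec), position u = x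
    · obtain ⟨u, rfl⟩ := hx
      simp only [position_injective.extend_apply, Pi.mul_apply]
      fun_prop
    · simp only [Function.extend_apply' _ _ _ hx]
      fun_prop

theorem entry_position (F : Dist Y₁ Y₂) (u : (MIdx × Y₁.Spec) × (MIdx × Y₂.Spec)) :
    entry q F (position u) = weight q u * F u :=
  position_injective.extend_apply _ _ u

theorem entry_of_notMem (F : Dist Y₁ Y₂) {x : Position} (hx : x ∉ specPairs Y₁ Y₂) :
    entry q F x = 0 :=
  Function.extend_apply' _ _ x fun h => hx (range_position Y₁ Y₂ ▸ h)

theorem entry_ext {F G : Dist Y₁ Y₂}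
    (h : ∀ x ∈ specPairs Y₁ Y₂, entry q F x = entry q G x) : F = G := by
  funext u
  have := h _ (position_mem u)
  rw [entry_position, entry_position] at this
  exact mul_left_cancel₀ (weight_ne_zero q u) this

/-- The operator on distributions which acts on matrix entries as the weighted shift with weight
`c` and translation `v`, cut off outside of the spectrum. -/
noncomputable def weightedShift (c : Position → ℂ) (v : Position) : Dist Y₁ Y₂ →L[ℂ] Dist Y₁ Y₂ :=
  ContinuousLinearMap.pi fun u =>
    ((weight q u)⁻¹ * c (position u)) • ContinuousLinearMap.proj (position u + v) ∘L entry q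

theorem entry_weightedShift (c : Position → ℂ) (v : Position) (F : Dist Y₁ Y₂) {x : Position}
    (hx : x ∈ specPairs Y₁ Y₂) :
    entry q (weightedShift q c v F) x = c x * entry q F (x + v) := by
  obtain ⟨u, rfl⟩ := (range_position Y₁ Y₂).symm ▸ hx
  rw [entry_position, weightedShift, ContinuousLinearMap.pi_apply, smul_apply,
    smul_eq_mul, mul_assoc, mul_inv_cancel_left₀ (weight_ne_zero q u)]
  rfl

theorem weightedShift_mul_weightedShift_neg {c c' : Position → ℂ} {v : Position}
    (hc : ∀ x, c x * c' (x + v) = 1)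
    (hv : ∀ x ∈ specPairs Y₁ Y₂, x + v ∈ specPairs Y₁ Y₂) :
    (weightedShift q c v * weightedShift q c' (-v) : Dist Y₁ Y₂ →L[ℂ] Dist Y₁ Y₂) = 1 := by
  refine ContinuousLinearMap.ext fun F => entry_ext q fun x hx => ?_
  rw [mul_apply_eq_comp, entry_weightedShift q _ _ _ hx,
    entry_weightedShift q _ _ _ (hv x hx), add_neg_cancel_right, ← mul_assoc, hc, one_mul,
    one_apply_eq_self]

theorem isUnit_weightedShift {c : Position → ℂ} {v : Position} (hc : ∀ x, c x ≠ 0)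
    (hv : ∀ x, x + v ∈ specPairs Y₁ Y₂ ↔ x ∈ specPairs Y₁ Y₂) :
    IsUnit (weightedShift q c v : Dist Y₁ Y₂ →L[ℂ] Dist Y₁ Y₂) := by
  refine ⟨⟨_, weightedShift q (fun x => (c (x + -v))⁻¹) (-v), ?_, ?_⟩, rfl⟩
  · refine weightedShift_mul_weightedShift_neg q (fun x => ?_) fun x => (hv x).2
    rw [add_neg_cancel_right, mul_inv_cancel₀ (hc x)]
  · rw [← neg_neg v, neg_neg (-v)]
    refine weightedShift_mul_weightedShift_neg q (fun x => inv_mul_cancel₀ (hc _)) fun x hx => ?_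
    rwa [← hv, neg_add_cancel_right]

theorem toDist_tmul (f₁ : (Pol q Y₁)ᵐᵒᵖ) (f₂ : Pol q Y₂) (u) :
    toDist q Y₁ Y₂ (f₁ ⊗ₜ f₂) u = coefVal q Y₁ f₁.unop u.1 * coefVal q Y₂ f₂ u.2 := by
  simp [toDist]

theorem entry_toDist_tmul (f₁ : (Pol q Y₁)ᵐᵒᵖ) (f₂ : Pol q Y₂) (x : Position) :
    entry q (toDist q Y₁ Y₂ (f₁ ⊗ₜ f₂)) x =
      specMatrix q Y₁ f₁.unop x.1 * specMatrix q Y₂ f₂ x.2 := by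
  by_cases hx : x ∈ specPairs Y₁ Y₂
  · rw [specMatrix, specMatrix, Set.indicator_of_mem hx.1, Set.indicator_of_mem hx.2]
    obtain ⟨u, rfl⟩ := (range_position Y₁ Y₂).symm ▸ hx
    rw [entry_position, toDist_tmul, position, Prod.map_fst, Prod.map_snd,
      matrixEntry_specPosition, matrixEntry_specPosition, weight, mul_mul_mul_comm]
  · rw [entry_of_notMem q _ hx]
    rcases not_and_or.1 hx with h | h
    · rw [specMatrix, Set.indicator_of_notMem h, zero_mul]
    · rw [specMatrix, specMatrix, Set.indicator_of_notMem h, mul_zero]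

variable {q} in
theorem IsMatrixShift.toDist_tensor {T₁ : Pol q Y₁ → Pol q Y₁} {T₂ : Pol q Y₂ → Pol q Y₂}
    {c₁ c₂ : ℤ × ℤ × ℤ → ℂ} {v₁ v₂ : ℤ × ℤ × ℤ}
    (h₁ : IsMatrixShift q T₁ c₁ v₁) (h₂ : IsMatrixShift q T₂ c₂ v₂)
    {T : Module.End ℂ (PolProd q Y₁ Y₂)}
    (hT : ∀ f₁ f₂, T (f₁ ⊗ₜ f₂) = MulOpposite.op (T₁ f₁.unop) ⊗ₜ T₂ f₂) (p : PolProd q Y₁ Y₂) :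
    toDist q Y₁ Y₂ (T p) =
      weightedShift q (fun x => c₁ x.1 * c₂ x.2) (v₁, v₂) (toDist q Y₁ Y₂ p) := by
  induction p using TensorProduct.induction_on with
  | zero => simp
  | add a b ha hb => simp only [map_add, ha, hb]
  | tmul f₁ f₂ =>
    refine entry_ext q fun x hx => ?_
    rw [hT, entry_weightedShift q _ _ _ hx, entry_toDist_tmul, entry_toDist_tmul,
      MulOpposite.unop_op, h₁ _ _ hx.1, h₂ _ _ hx.2, mul_mul_mul_comm]
    rfl

end Entries

section Density

variable (q : QParam)

theorem c_zpow_neg_two_mul_injective : Function.Injective fun m : ℤ => q.c ^ (-2 * m) := by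
  intro m n h
  have : q.c ^ (-2 * m - -2 * n) = 1 := by
    rw [zpow_sub₀ q.c_ne_zero, div_eq_one_iff_eq (zpow_ne_zero _ q.c_ne_zero)]
    exact h
  rw [q.c_zpow_eq_one_iff] at this
  lia

theorem exists_coefVal_eq_single [DecidableEq MIdx] (Y : QSpace) (u : MIdx × Y.Spec)
    (I : Finset (MIdx × Y.Spec)) :
    ∃ f : Pol q Y, ∀ v ∈ I, coefVal q Y f v = Pi.single (M := fun _ => ℂ) u 1 v := by
  let node : Y.Spec → ℂ := fun m => q.c ^ (-2 * (m : ℤ))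
  have hnode : Function.Injective node :=
    (c_zpow_neg_two_mul_injective q).comp Subtype.val_injective
  let P : ℂ[X] := Lagrange.interpolate (I.image Prod.snd) node (Pi.single u.2 1)
  refine ⟨normalForm q Y (Finsupp.single u.1 P), fun v hv => ?_⟩
  rw [coefVal_normalForm, Finsupp.single_apply]
  split_ifs with h
  · rw [Lagrange.eval_interpolate_at_node (v := node) _ hnode.injOn
      (Finset.mem_image_of_mem _ hv)]
    simp [Pi.single_apply, Prod.ext_iff, h]
  · rw [eval_zero, Pi.single_eq_of_ne]
    rintro rfl
    exact h rfl

variable {Y₁ Y₂ : QSpace}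

theorem exists_toDist_eqOn (I : Finset ((MIdx × Y₁.Spec) × (MIdx × Y₂.Spec))) (F : Dist Y₁ Y₂) :
    ∃ p, ∀ u ∈ I, toDist q Y₁ Y₂ p u = F u := by
  classical
  have hsingle : ∀ u, ∃ p, ∀ v ∈ I, toDist q Y₁ Y₂ p v = Pi.single (M := fun _ => ℂ) u 1 v := by
    intro u
    obtain ⟨f₁, h₁⟩ := exists_coefVal_eq_single q Y₁ u.1 (I.image Prod.fst)
    obtain ⟨f₂, h₂⟩ := exists_coefVal_eq_single q Y₂ u.2 (I.image Prod.snd)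
    refine ⟨MulOpposite.op f₁ ⊗ₜ f₂, fun v hv => ?_⟩
    rw [toDist_tmul, MulOpposite.unop_op, h₁ _ (Finset.mem_image_of_mem _ hv),
      h₂ _ (Finset.mem_image_of_mem _ hv)]
    simp only [Pi.single_apply, ite_zero_mul_ite_zero, one_mul, Prod.ext_iff]
  choose p hp using hsingle
  refine ⟨∑ u ∈ I, F u • p u, fun v hv => ?_⟩
  rw [map_sum, Finset.sum_apply, Finset.sum_eq_single_of_mem v hv fun u _ hne => ?_]
  · simp [hp v v hv]
  · simp [hp u v hv, hne.symm]

theorem denseRange_toDist : DenseRange (toDist q Y₁ Y₂) := by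
  intro F
  rw [mem_closure_iff_nhds]
  intro s hs
  rw [nhds_pi, Filter.mem_pi'] at hs
  obtain ⟨I, t, ht, hs⟩ := hs
  obtain ⟨p, hp⟩ := exists_toDist_eqOn q I F
  exact ⟨toDist q Y₁ Y₂ p, hs fun u hu => hp u hu ▸ mem_of_mem_nhds (ht u), p, rfl⟩

theorem limUnder_toDist {Z : Type*} [TopologicalSpace Z] [T2Space Z] [Nonempty Z]
    {φ : PolProd q Y₁ Y₂ → Z} {Φ : Dist Y₁ Y₂ → Z} (hΦ : Continuous Φ)
    (h : ∀ p, φ p = Φ (toDist q Y₁ Y₂ p)) (F : Dist Y₁ Y₂) :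
    limUnder (comap (toDist q Y₁ Y₂) (𝓝 F)) φ = Φ F := by
  have : (comap (toDist q Y₁ Y₂) (𝓝 F)).NeBot :=
    comap_neBot fun s hs => by
      obtain ⟨_, h, p, rfl⟩ := mem_closure_iff_nhds.1 (denseRange_toDist q F) s hs
      exact ⟨p, h⟩
  rw [funext h]
  exact ((hΦ.tendsto F).comp tendsto_comap).limUnder_eq

end Density

section Actions

variable (q : QParam) (Y₁ Y₂ : QSpace)

theorem adjoin_range_t_union_range_tau :
    Algebra.adjoin ℂ (Set.range (t q Y₁ Y₂) ∪ Set.range (tau q Y₁ Y₂)) = ⊤ := by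
  have hleft : Set.range (t q Y₁ Y₂) = (Algebra.TensorProduct.includeLeft : _ →ₐ[ℂ] _) ''
      (MulOpposite.unop ⁻¹' Set.range (gen q Y₁)) := by
    refine Set.Subset.antisymm (Set.range_subset_iff.2 fun g => ⟨_, ⟨g, rfl⟩, rfl⟩) ?_
    rintro _ ⟨⟨f⟩, ⟨g, rfl⟩, rfl⟩
    exact ⟨g, rfl⟩
  have hright : Set.range (tau q Y₁ Y₂) = (Algebra.TensorProduct.includeRight : _ →ₐ[ℂ] _) ''
      Set.range (gen q Y₂) := Set.range_comp _ _
  rw [Algebra.adjoin_union, hleft, hright, ← AlgHom.map_adjoin, ← AlgHom.map_adjoin,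
    ← Subalgebra.op_adjoin, adjoin_range_gen, adjoin_range_gen, Subalgebra.op_top,
    Algebra.map_top, Algebra.map_top]
  simpa using (Algebra.TensorProduct.map_range (AlgHom.id ℂ (Pol q Y₁)ᵐᵒᵖ)
    (AlgHom.id ℂ (Pol q Y₂))).symm

variable {Y₁ Y₂}

theorem eq_of_forall_toDist {Z : Type*} [TopologicalSpace Z] [T2Space Z] {Φ Ψ : Dist Y₁ Y₂ → Z}
    (hΦ : Continuous Φ) (hΨ : Continuous Ψ)
    (h : ∀ p, Φ (toDist q Y₁ Y₂ p) = Ψ (toDist q Y₁ Y₂ p)) : Φ = Ψ :=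
  (denseRange_toDist q).equalizer hΦ hΨ (funext h)

/-- The operators on `Pol(Y₁ × Y₂)_q` which extend by continuity to distributions. -/
def extensible (Y₁ Y₂ : QSpace) : Subalgebra ℂ (Module.End ℂ (PolProd q Y₁ Y₂)) where
  carrier := {T | ∃ L : Dist Y₁ Y₂ →L[ℂ] Dist Y₁ Y₂,
    ∀ p, toDist q Y₁ Y₂ (T p) = L (toDist q Y₁ Y₂ p)}
  mul_mem' := fun ⟨L, hL⟩ ⟨M, hM⟩ => ⟨L * M, fun p => (hL _).trans (congrArg L (hM p))⟩
  add_mem' := fun ⟨L, hL⟩ ⟨M, hM⟩ => ⟨L + M, fun p =>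
    (map_add _ _ _).trans (congrArg₂ (· + ·) (hL p) (hM p))⟩
  algebraMap_mem' r := ⟨r • 1, fun p => map_smul _ r p⟩

/-- The extension by continuity of operators from `Pol(Y₁ × Y₂)_q` to distributions. -/
noncomputable def extend : extensible q Y₁ Y₂ →ₐ[ℂ] (Dist Y₁ Y₂ →L[ℂ] Dist Y₁ Y₂) :=
  have hext {T : extensible q Y₁ Y₂} {L : Dist Y₁ Y₂ →L[ℂ] Dist Y₁ Y₂}
      (hL : ∀ p, toDist q Y₁ Y₂ (T.1 p) = L (toDist q Y₁ Y₂ p)) : T.2.choose = L :=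
    DFunLike.coe_injective <| eq_of_forall_toDist q T.2.choose.continuous L.continuous fun p =>
      (T.2.choose_spec p).symm.trans (hL p)
  { toFun T := T.2.choose
    map_one' := hext fun _ => rfl
    map_zero' := hext fun _ => map_zero _
    map_mul' S T := hext fun p =>
      (S.2.choose_spec _).trans (congrArg S.2.choose (T.2.choose_spec p))
    map_add' S T := hext fun p => (map_add _ _ _).trans
      (congrArg₂ (· + ·) (S.2.choose_spec p) (T.2.choose_spec p))
    commutes' r := hext fun p => map_smul _ r p }

theorem extend_toDist (T : extensible q Y₁ Y₂) (p : PolProd q Y₁ Y₂) :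
    extend q T (toDist q Y₁ Y₂ p) = toDist q Y₁ Y₂ (T.1 p) :=
  (T.2.choose_spec p).symm

theorem toDist_tmul_mul {a : Pol q Y₁} {b : Pol q Y₂} {c₁ c₂ : ℤ × ℤ × ℤ → ℂ}
    {v₁ v₂ : ℤ × ℤ × ℤ} (ha : IsMatrixShift q (· * a) c₁ v₁) (hb : IsMatrixShift q (b * ·) c₂ v₂)
    (p : PolProd q Y₁ Y₂) : toDist q Y₁ Y₂ (MulOpposite.op a ⊗ₜ b * p) =
      weightedShift q (fun x => c₁ x.1 * c₂ x.2) (v₁, v₂) (toDist q Y₁ Y₂ p) :=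
  ha.toDist_tensor hb (T := LinearMap.mulLeft ℂ (MulOpposite.op a ⊗ₜ b)) (by simp) p

theorem toDist_mul_tmul {a : Pol q Y₁} {b : Pol q Y₂} {c₁ c₂ : ℤ × ℤ × ℤ → ℂ}
    {v₁ v₂ : ℤ × ℤ × ℤ} (ha : IsMatrixShift q (a * ·) c₁ v₁) (hb : IsMatrixShift q (· * b) c₂ v₂)
    (p : PolProd q Y₁ Y₂) : toDist q Y₁ Y₂ (p * MulOpposite.op a ⊗ₜ b) =
      weightedShift q (fun x => c₁ x.1 * c₂ x.2) (v₁, v₂) (toDist q Y₁ Y₂ p) :=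
  ha.toDist_tensor hb (T := LinearMap.mulRight ℂ (MulOpposite.op a ⊗ₜ b)) (by simp) p

theorem isMatrixShift_one_mul (Y : QSpace) : IsMatrixShift q ((1 : Pol q Y) * ·) 1 0 := by
  simp [IsMatrixShift]

theorem isMatrixShift_mul_one (Y : QSpace) : IsMatrixShift q (· * (1 : Pol q Y)) 1 0 := by
  simp [IsMatrixShift]

theorem lmul_mem_extensible (K : PolProd q Y₁ Y₂) :
    Algebra.lmul ℂ _ K ∈ extensible q Y₁ Y₂ := by
  suffices h : (extensible q Y₁ Y₂).comap (Algebra.lmul ℂ _) = ⊤ from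
    (h ▸ Algebra.mem_top : K ∈ (extensible q Y₁ Y₂).comap (Algebra.lmul ℂ _))
  rw [← top_le_iff, ← adjoin_range_t_union_range_tau, Algebra.adjoin_le_iff, Set.union_subset_iff,
    Set.range_subset_iff, Set.range_subset_iff]
  constructor <;> intro g
  · exact ⟨_, toDist_tmul_mul q (isMatrixShift_mul_gen q Y₁ g) (isMatrixShift_one_mul q Y₂)⟩
  · exact ⟨_, toDist_tmul_mul q (isMatrixShift_mul_one q Y₁) (isMatrixShift_gen_mul q Y₂ g)⟩

theorem lsmul_op_mem_extensible (K : (PolProd q Y₁ Y₂)ᵐᵒᵖ) :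
    Algebra.lsmul ℂ ℂ _ K ∈ extensible q Y₁ Y₂ := by
  suffices h : (extensible q Y₁ Y₂).comap (Algebra.lsmul ℂ ℂ _) = ⊤ from
    (h ▸ Algebra.mem_top : K ∈ (extensible q Y₁ Y₂).comap (Algebra.lsmul ℂ ℂ _))
  rw [← top_le_iff, ← Subalgebra.op_top, ← adjoin_range_t_union_range_tau, Subalgebra.op_adjoin,
    Algebra.adjoin_le_iff]
  rintro ⟨K⟩ (⟨g, rfl⟩ | ⟨g, rfl⟩)
  · exact ⟨_, toDist_mul_tmul q (isMatrixShift_gen_mul q Y₁ g) (isMatrixShift_mul_one q Y₂)⟩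
  · exact ⟨_, toDist_mul_tmul q (isMatrixShift_one_mul q Y₁) (isMatrixShift_mul_gen q Y₂ g)⟩

/-- The left action of `Pol(Y₁ × Y₂)_q` on distributions, as a homomorphism of algebras. -/
noncomputable def leftAction : PolProd q Y₁ Y₂ →ₐ[ℂ] (Dist Y₁ Y₂ →L[ℂ] Dist Y₁ Y₂) :=
  (extend q).comp ((Algebra.lmul ℂ _).codRestrict _ (lmul_mem_extensible q))

/-- The right action of `Pol(Y₁ × Y₂)_q` on distributions, as a homomorphism of algebras. -/
noncomputable def rightAction : (PolProd q Y₁ Y₂)ᵐᵒᵖ →ₐ[ℂ] (Dist Y₁ Y₂ →L[ℂ] Dist Y₁ Y₂) :=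
  (extend q).comp ((Algebra.lsmul ℂ ℂ _).codRestrict _ (lsmul_op_mem_extensible q))

theorem leftAction_toDist (K p : PolProd q Y₁ Y₂) :
    leftAction q K (toDist q Y₁ Y₂ p) = toDist q Y₁ Y₂ (K * p) :=
  extend_toDist q _ p

theorem rightAction_toDist (K p : PolProd q Y₁ Y₂) :
    rightAction q (.op K) (toDist q Y₁ Y₂ p) = toDist q Y₁ Y₂ (p * K) :=
  extend_toDist q _ p

theorem coe_leftAction (K : PolProd q Y₁ Y₂) : ⇑(leftAction q K) = leftMul q K :=
  funext fun F => (limUnder_toDist q (leftAction q K).continuous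
    (fun p => (leftAction_toDist q K p).symm) F).symm

theorem coe_rightAction (K : PolProd q Y₁ Y₂) : ⇑(rightAction q (.op K)) = rightMul q K :=
  funext fun F => (limUnder_toDist q (rightAction q (.op K)).continuous
    (fun p => (rightAction_toDist q K p).symm) F).symm

theorem leftAction_one (K : PolProd q Y₁ Y₂) :
    leftAction q K (one q Y₁ Y₂) = toDist q Y₁ Y₂ K := by
  rw [one, leftAction_toDist, mul_one]

theorem rightAction_one (K : PolProd q Y₁ Y₂) :
    rightAction q (.op K) (one q Y₁ Y₂) = toDist q Y₁ Y₂ K := by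
  rw [one, rightAction_toDist, one_mul]

theorem commute_leftAction_rightAction (K : PolProd q Y₁ Y₂) (L : (PolProd q Y₁ Y₂)ᵐᵒᵖ) :
    Commute (leftAction q K) (rightAction q L) := by
  refine DFunLike.coe_injective (eq_of_forall_toDist q (ContinuousLinearMap.continuous _)
    (ContinuousLinearMap.continuous _) fun p => ?_)
  induction L using MulOpposite.rec'
  simp only [mul_apply_eq_comp, rightAction_toDist, leftAction_toDist, mul_assoc]

theorem leftAction_tmul {a : Pol q Y₁} {b : Pol q Y₂} {c₁ c₂ : ℤ × ℤ × ℤ → ℂ}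
    {v₁ v₂ : ℤ × ℤ × ℤ} (ha : IsMatrixShift q (· * a) c₁ v₁)
    (hb : IsMatrixShift q (b * ·) c₂ v₂) : leftAction q (MulOpposite.op a ⊗ₜ b) =
      weightedShift q (fun x => c₁ x.1 * c₂ x.2) (v₁, v₂) :=
  DFunLike.coe_injective (eq_of_forall_toDist q (ContinuousLinearMap.continuous _)
    (ContinuousLinearMap.continuous _) fun p => (leftAction_toDist q _ p).trans
      (toDist_tmul_mul q ha hb p))

theorem rightAction_tmul {a : Pol q Y₁} {b : Pol q Y₂} {c₁ c₂ : ℤ × ℤ × ℤ → ℂ}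
    {v₁ v₂ : ℤ × ℤ × ℤ} (ha : IsMatrixShift q (a * ·) c₁ v₁)
    (hb : IsMatrixShift q (· * b) c₂ v₂) : rightAction q (.op (MulOpposite.op a ⊗ₜ b)) =
      weightedShift q (fun x => c₁ x.1 * c₂ x.2) (v₁, v₂) :=
  DFunLike.coe_injective (eq_of_forall_toDist q (ContinuousLinearMap.continuous _)
    (ContinuousLinearMap.continuous _) fun p => (rightAction_toDist q _ p).trans
      (toDist_mul_tmul q ha hb p))

end Actions

section Kernel

variable (q : QParam) {Y₁ Y₂ : QSpace}

theorem t_mul_tau (g h : Gen) :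
    t q Y₁ Y₂ g * tau q Y₁ Y₂ h = MulOpposite.op (gen q Y₁ g) ⊗ₜ gen q Y₂ h := by
  rw [t, tau, Algebra.TensorProduct.tmul_mul_tmul, mul_one, one_mul]

theorem commute_t_tau (g h : Gen) : Commute (t q Y₁ Y₂ g) (tau q Y₁ Y₂ h) := by
  rw [Commute, SemiconjBy, t_mul_tau, t, tau, Algebra.TensorProduct.tmul_mul_tmul, mul_one, one_mul]

theorem k11_eq_add_lead :
    k11 q Y₁ Y₂ = t q Y₁ Y₂ .t11 * tau q Y₁ Y₂ .t22 + lead q Y₁ Y₂ := sub_eq_add_neg _ _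

theorem lead_eq : lead q Y₁ Y₂ = (-q.c) • (t q Y₁ Y₂ .t12 * tau q Y₁ Y₂ .t21) :=
  (neg_smul q.c (t q Y₁ Y₂ .t12 * tau q Y₁ Y₂ .t21)).symm

theorem t11_tau22_mul_lead :
    t q Y₁ Y₂ .t11 * tau q Y₁ Y₂ .t22 * lead q Y₁ Y₂ =
      (q.c ^ 2)⁻¹ • (lead q Y₁ Y₂ * (t q Y₁ Y₂ .t11 * tau q Y₁ Y₂ .t22)) := by
  simp only [lead_eq, t_mul_tau, mul_smul_comm, smul_mul_assoc,
    Algebra.TensorProduct.tmul_mul_tmul, ← MulOpposite.op_mul]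
  rw [e1, e2, MulOpposite.op_smul, smul_tmul_smul, smul_comm (-q.c), ← sq,
    inv_smul_smul₀ (pow_ne_zero 2 q.c_ne_zero)]

theorem isUnit_leftAction_t12 : IsUnit (leftAction q (t q Y₁ Y₂ .t12)) := by
  rw [t, leftAction_tmul q (isMatrixShift_mul_gen q Y₁ .t12) (isMatrixShift_one_mul q Y₂)]
  refine isUnit_weightedShift q (fun x => ?_) fun x => ?_
  · simpa [colCoeff] using zpow_ne_zero _ q.c_ne_zero
  · simp [specPositions, colShift]

theorem isUnit_leftAction_tau21 : IsUnit (leftAction q (tau q Y₁ Y₂ .t21)) := by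
  rw [tau, ← MulOpposite.op_one,
    leftAction_tmul q (isMatrixShift_mul_one q Y₁) (isMatrixShift_gen_mul q Y₂ .t21)]
  refine isUnit_weightedShift q (fun x => ?_) fun x => ?_
  · simpa [rowCoeff, q.c_ne_zero] using zpow_ne_zero _ q.c_ne_zero
  · simp [specPositions, rowShift]

theorem isUnit_leftAction_lead : IsUnit (leftAction q (lead q Y₁ Y₂)) := by
  have hlead : lead q Y₁ Y₂ =
      algebraMap ℂ _ (-q.c) * (t q Y₁ Y₂ .t12 * tau q Y₁ Y₂ .t21) :=
    (lead_eq q).trans (Algebra.smul_def (A := PolProd q Y₁ Y₂) (-q.c) _)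
  have hq : IsUnit (algebraMap ℂ (PolProd q Y₁ Y₂) (-q.c)) :=
    (IsUnit.mk0 _ (neg_ne_zero.2 q.c_ne_zero)).map _
  rw [hlead, map_mul, map_mul]
  exact (hq.map _).mul ((isUnit_leftAction_t12 q).mul (isUnit_leftAction_tau21 q))

theorem bijective_leftMul {K : PolProd q Y₁ Y₂} (hK : IsUnit (leftAction q K)) :
    Function.Bijective (leftMul q K) := by
  rw [← coe_leftAction]
  exact (Module.End.isUnit_iff _).1 (hK.map ContinuousLinearMap.toLinearMapRingHom)

theorem leftAction_injective {K : PolProd q Y₁ Y₂} (hK : IsUnit (leftAction q K)) :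
    Function.Injective (leftAction q K) :=
  coe_leftAction q K ▸ (bijective_leftMul q hK).injective

theorem leftAction_inverse_apply {K : PolProd q Y₁ Y₂} (hK : IsUnit (leftAction q K))
    (F : Dist Y₁ Y₂) : leftAction q K (Ring.inverse (leftAction q K) F) = F := by
  rw [← mul_apply_eq_comp, Ring.mul_inverse_cancel _ hK, one_apply_eq_self]

theorem leftDiv_eq {K : PolProd q Y₁ Y₂} (hK : IsUnit (leftAction q K)) (F : Dist Y₁ Y₂) :
    leftDiv q K F = Ring.inverse (leftAction q K) F := by
  conv_lhs => rw [leftDiv, ← coe_leftAction, ← leftAction_inverse_apply q hK F]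
  exact Function.leftInverse_invFun (leftAction_injective q hK) _

theorem leftDiv_injective {K : PolProd q Y₁ Y₂} (hK : IsUnit (leftAction q K)) :
    Function.Injective (leftDiv q K) :=
  (Function.rightInverse_invFun (bijective_leftMul q hK).surjective).injective

/-- The operator `g ↦ z ζ^* g` on distributions. -/
noncomputable def zZetaMul : Dist Y₁ Y₂ →L[ℂ] Dist Y₁ Y₂ :=
  q.c • (Ring.inverse (leftAction q (t q Y₁ Y₂ .t12)) * leftAction q (t q Y₁ Y₂ .t11) *
    (Ring.inverse (leftAction q (tau q Y₁ Y₂ .t21)) * leftAction q (tau q Y₁ Y₂ .t22)))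

theorem zZetaMul_apply (F : Dist Y₁ Y₂) : zZetaMul q F = zMul q (zetaStarMul q F) := by
  rw [zMul, zetaStarMul, leftDiv_eq q (isUnit_leftAction_t12 q),
    leftDiv_eq q (isUnit_leftAction_tau21 q), ← coe_leftAction, ← coe_leftAction]
  rfl

theorem zZetaPow_zero : zZetaPow q Y₁ Y₂ 0 = one q Y₁ Y₂ := rfl

theorem zZetaPow_succ (n : ℕ) : zZetaPow q Y₁ Y₂ (n + 1) = zZetaMul q (zZetaPow q Y₁ Y₂ n) :=
  (Function.iterate_succ_apply' _ n _).trans (zZetaMul_apply q _).symm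

theorem leftAction_mul_apply (K L : PolProd q Y₁ Y₂) (F : Dist Y₁ Y₂) :
    leftAction q (K * L) F = leftAction q K (leftAction q L F) := by
  rw [map_mul, mul_apply_eq_comp]

theorem leftAction_smul_apply (c : ℂ) (K : PolProd q Y₁ Y₂) (F : Dist Y₁ Y₂) :
    leftAction q (c • K) F = c • leftAction q K F := by
  rw [map_smul, smul_apply]

theorem leftAction_rightAction (K : PolProd q Y₁ Y₂) (L : (PolProd q Y₁ Y₂)ᵐᵒᵖ) (F : Dist Y₁ Y₂) :
    leftAction q K (rightAction q L F) = rightAction q L (leftAction q K F) :=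
  congrArg (· F) (commute_leftAction_rightAction q K L).eq

theorem lead_zZetaMul (F : Dist Y₁ Y₂) :
    leftAction q (lead q Y₁ Y₂) (zZetaMul q F) =
      -(q.c ^ 2 • leftAction q (t q Y₁ Y₂ .t11 * tau q Y₁ Y₂ .t22) F) := by
  rw [lead_eq, leftAction_smul_apply, (commute_t_tau q .t12 .t21).eq, leftAction_mul_apply,
    zZetaMul, smul_apply, map_smul, map_smul, mul_apply_eq_comp, mul_apply_eq_comp,
    leftAction_inverse_apply q (isUnit_leftAction_t12 q), ← leftAction_mul_apply,
    ← (commute_t_tau q .t11 .t21).eq, leftAction_mul_apply, mul_apply_eq_comp,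
    leftAction_inverse_apply q (isUnit_leftAction_tau21 q), ← leftAction_mul_apply, smul_smul,
    neg_mul, ← sq, neg_smul]

theorem zZetaMul_lead (F : Dist Y₁ Y₂) :
    zZetaMul q (leftAction q (lead q Y₁ Y₂) F) =
      (q.c ^ 2)⁻¹ • leftAction q (lead q Y₁ Y₂) (zZetaMul q F) := by
  refine leftAction_injective q (isUnit_leftAction_lead q) ?_
  rw [lead_zZetaMul, ← leftAction_mul_apply, t11_tau22_mul_lead, leftAction_smul_apply,
    leftAction_mul_apply, lead_zZetaMul, map_smul, map_neg, map_smul, smul_neg, smul_comm]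

theorem zZetaMul_rightAction (L : (PolProd q Y₁ Y₂)ᵐᵒᵖ) (F : Dist Y₁ Y₂) :
    zZetaMul q (rightAction q L F) = rightAction q L (zZetaMul q F) := by
  refine leftAction_injective q (isUnit_leftAction_lead q) ?_
  rw [lead_zZetaMul, leftAction_rightAction, leftAction_rightAction, lead_zZetaMul, map_neg,
    map_smul]

theorem rightAction_k11_one :
    rightAction q (.op (k11 q Y₁ Y₂)) (one q Y₁ Y₂) =
      leftAction q (lead q Y₁ Y₂) (one q Y₁ Y₂ - (q.c ^ 2)⁻¹ • zZetaMul q (one q Y₁ Y₂)) := by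
  rw [rightAction_one, ← leftAction_one, k11_eq_add_lead, map_add, add_apply, map_sub, map_smul,
    lead_zZetaMul, smul_neg, inv_smul_smul₀ (pow_ne_zero 2 q.c_ne_zero), sub_neg_eq_add, add_comm]

theorem rightAction_k11_zZetaPow (n : ℕ) :
    rightAction q (.op (k11 q Y₁ Y₂)) (zZetaPow q Y₁ Y₂ n) =
      leftAction q (lead q Y₁ Y₂) (((q.c ^ 2)⁻¹) ^ n • zZetaPow q Y₁ Y₂ n -
        ((q.c ^ 2)⁻¹) ^ (n + 1) • zZetaPow q Y₁ Y₂ (n + 1)) := by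
  induction n with
  | zero =>
    rw [pow_zero, one_smul, zero_add, pow_one, zZetaPow_succ]
    exact rightAction_k11_one q
  | succ n ih =>
    rw [zZetaPow_succ q n, ← zZetaMul_rightAction, ih, zZetaMul_lead, map_sub (zZetaMul q),
      map_smul (zZetaMul q), map_smul (zZetaMul q), ← zZetaPow_succ, ← zZetaPow_succ, ← map_smul,
      smul_sub, smul_smul, smul_smul, ← pow_succ', ← pow_succ']

end Kernel

section KernelSeries

variable (q : QParam) {Y₁ Y₂ : QSpace}

/-- The position of the coefficient `ψ_{0000}(q^{-2m})`. -/
def diagonal {Y : QSpace} (m : Y.Spec) : ℤ × ℤ × ℤ := (m, m, 0)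

theorem diagonal_injective (Y : QSpace) : Function.Injective (diagonal (Y := Y)) :=
  fun _ _ h => Subtype.ext (congrArg Prod.fst h)

theorem specMatrix_one (Y : QSpace) :
    specMatrix q Y 1 = (Set.range (diagonal (Y := Y))).indicator 1 := by
  classical
  have hmem (x : ℤ × ℤ × ℤ) : x ∈ Set.range (diagonal (Y := Y)) ↔
      x ∈ specPositions Y ∧ (x.1, x.2.2) = (x.2.1, 0) := by
    refine ⟨?_, fun ⟨h, hx⟩ => ⟨⟨x.1, fun hY => (h hY).1⟩, ?_⟩⟩
    · rintro ⟨m, rfl⟩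
      exact ⟨fun hY => ⟨m.2 hY, m.2 hY⟩, rfl⟩
    · obtain ⟨h₁, h₂⟩ := Prod.mk.inj hx
      exact Prod.ext rfl (Prod.ext h₁ h₂.symm)
  funext x
  rw [specMatrix, Set.indicator_apply, Set.indicator_apply, matrixEntry_apply, map_one,
    Module.End.one_apply, Pi.single_apply, ← ite_and, Pi.one_apply]
  exact if_congr (hmem x).symm rfl rfl

theorem entry_one : entry q (one q Y₁ Y₂) =
    (Set.range (Prod.map (diagonal (Y := Y₁)) (diagonal (Y := Y₂)))).indicator 1 := by
  funext x
  rw [one, Algebra.TensorProduct.one_def, entry_toDist_tmul, MulOpposite.unop_one, specMatrix_one,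
    specMatrix_one, Set.range_prodMap, Set.indicator_prod_one]

theorem entry_leftAction_t_mul_tau (g h : Gen) (F : Dist Y₁ Y₂) {x : Position}
    (hx : x ∈ specPairs Y₁ Y₂) :
    entry q (leftAction q (t q Y₁ Y₂ g * tau q Y₁ Y₂ h) F) x =
      colCoeff q Y₁ g x.1 * rowCoeff q Y₂ h x.2 * entry q F (x + (colShift g, rowShift h)) := by
  rw [t_mul_tau, leftAction_tmul q (isMatrixShift_mul_gen q Y₁ g) (isMatrixShift_gen_mul q Y₂ h),
    entry_weightedShift q _ _ _ hx]

theorem entry_rightAction_t_mul_tau (g h : Gen) (F : Dist Y₁ Y₂) {x : Position}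
    (hx : x ∈ specPairs Y₁ Y₂) :
    entry q (rightAction q (.op (t q Y₁ Y₂ g * tau q Y₁ Y₂ h)) F) x =
      rowCoeff q Y₁ g x.1 * colCoeff q Y₂ h x.2 * entry q F (x + (rowShift g, colShift h)) := by
  rw [t_mul_tau, rightAction_tmul q (isMatrixShift_gen_mul q Y₁ g) (isMatrixShift_mul_gen q Y₂ h),
    entry_weightedShift q _ _ _ hx]

theorem entry_zZetaMul_eq_zero {F : Dist Y₁ Y₂} {x : Position}
    (h : entry q F (x + ((0, 1, 1), (1, 0, -1))) = 0) : entry q (zZetaMul q F) x = 0 := by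
  by_cases hx : x ∈ specPairs Y₁ Y₂
  swap
  · exact entry_of_notMem q _ hx
  set y : Position := x + ((0, 0, 1), (0, 0, -1)) with hy
  have hymem : y ∈ specPairs Y₁ Y₂ := by simpa [hy, specPositions] using hx
  have hyx : y + (colShift .t12, rowShift .t21) = x := by
    rw [hy, add_assoc]; exact add_zero x
  have hyx' : y + (colShift .t11, rowShift .t22) = x + ((0, 1, 1), (1, 0, -1)) := by
    rw [hy, add_assoc]; rfl
  have hlead := congrArg (fun G => entry q G y) (lead_zZetaMul q F)
  simp only [lead_eq, map_smul, smul_apply, map_neg, Pi.smul_apply, Pi.neg_apply,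
    smul_eq_mul] at hlead
  rw [entry_leftAction_t_mul_tau q _ _ _ hymem, entry_leftAction_t_mul_tau q _ _ _ hymem, hyx,
    hyx', h, mul_zero, mul_zero, neg_zero] at hlead
  simpa [colCoeff, rowCoeff, q.c_ne_zero, zpow_ne_zero] using hlead

theorem entry_zZetaPow_eq_zero {n : ℕ} {x : Position} (hx : x.1.1 - x.1.2.1 ≠ n) :
    entry q (zZetaPow q Y₁ Y₂ n) x = 0 := by
  induction n generalizing x with
  | zero =>
    rw [zZetaPow_zero, entry_one, Set.indicator_of_notMem]
    rintro ⟨m, rfl⟩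
    exact hx (sub_self _)
  | succ n ih =>
    rw [zZetaPow_succ]
    refine entry_zZetaMul_eq_zero q (ih ?_)
    simp only [Prod.fst_add, Prod.snd_add]
    lia

theorem zZetaPow_apply_eq_zero {n : ℕ} {u : (MIdx × Y₁.Spec) × (MIdx × Y₂.Spec)}
    (hn : n ≠ u.1.1.i1) : zZetaPow q Y₁ Y₂ n u = 0 := by
  have hpos : (position u).1.1 - (position u).1.2.1 ≠ n := by
    have h := u.1.1.h1
    rw [Nat.mul_eq_zero] at h
    simp only [position, Prod.map_fst, specPosition, matrixPosition, Equiv.coe_fn_mk]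
    lia
  have h := entry_zZetaPow_eq_zero q (Y₁ := Y₁) (Y₂ := Y₂) hpos
  rw [entry_position] at h
  exact (mul_eq_zero.1 h).resolve_left (weight_ne_zero q u)

theorem hasSum_smul_zZetaPow (a : ℕ → ℂ) :
    HasSum (fun n => a n • zZetaPow q Y₁ Y₂ n)
      fun u => a u.1.1.i1 * zZetaPow q Y₁ Y₂ u.1.1.i1 u :=
  Pi.hasSum.2 fun u => hasSum_single u.1.1.i1 fun n hn => by
    rw [Pi.smul_apply, zZetaPow_apply_eq_zero q hn, smul_zero]

theorem summable_smul_zZetaPow (a : ℕ → ℂ) : Summable fun n => a n • zZetaPow q Y₁ Y₂ n :=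
  (hasSum_smul_zZetaPow q a).summable

/-- The coefficients `(λ; q²)_n / (q²; q²)_n` of the `q`-binomial series. -/
noncomputable def qBinomialCoeff (lam : ℂ) (n : ℕ) : ℂ := qPoch q lam n / qPoch q (q.c ^ 2) n

variable (Y₁ Y₂) in
/-- The `q`-binomial series `f(λ) = ∑ₙ (λ; q²)_n / (q²; q²)_n (z ζ^*)^n`. -/
noncomputable def kernelSeries (lam : ℂ) : Dist Y₁ Y₂ :=
  ∑' n, qBinomialCoeff q lam n • zZetaPow q Y₁ Y₂ n

theorem kernelSeries_apply (lam : ℂ) (u : (MIdx × Y₁.Spec) × (MIdx × Y₂.Spec)) :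
    kernelSeries q Y₁ Y₂ lam u =
      qBinomialCoeff q lam u.1.1.i1 * zZetaPow q Y₁ Y₂ u.1.1.i1 u :=
  congrFun (hasSum_smul_zZetaPow q _).tsum_eq u

theorem qBinomialCoeff_zero (lam : ℂ) : qBinomialCoeff q lam 0 = 1 := by
  simp [qBinomialCoeff, qPoch]

theorem qBinomialCoeff_one_succ (n : ℕ) : qBinomialCoeff q 1 (n + 1) = 0 := by
  simp [qBinomialCoeff, qPoch, Finset.prod_range_succ']

theorem kernelSeries_one : kernelSeries q Y₁ Y₂ 1 = one q Y₁ Y₂ := by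
  rw [kernelSeries, tsum_eq_single 0, qBinomialCoeff_zero, one_smul, zZetaPow_zero]
  intro n hn
  obtain ⟨m, rfl⟩ := Nat.exists_eq_succ_of_ne_zero hn
  rw [Nat.succ_eq_add_one, qBinomialCoeff_one_succ, zero_smul]

theorem qPoch_succ (a : ℂ) (n : ℕ) : qPoch q a (n + 1) = qPoch q a n * (1 - a * q.c ^ (2 * n)) :=
  Finset.prod_range_succ _ n

theorem qPoch_succ' (a : ℂ) (n : ℕ) :
    qPoch q a (n + 1) = (1 - a) * qPoch q (a * q.c ^ 2) n := by
  simp only [qPoch, Finset.prod_range_succ', mul_zero, pow_zero, mul_one, mul_add, pow_add,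
    mul_comm (q.c ^ (2 * _)), mul_assoc]
  exact mul_comm _ _

theorem qPoch_ne_zero (n : ℕ) : qPoch q (q.c ^ 2) n ≠ 0 := by
  refine Finset.prod_ne_zero_iff.2 fun j _ => sub_ne_zero.2 (Ne.symm ?_)
  rw [← pow_add]
  exact q.c_pow_ne_one _ (by lia)

theorem qBinomialCoeff_succ_sub (lam : ℂ) (n : ℕ) :
    qBinomialCoeff q (lam * q.c ^ 2) (n + 1) - qBinomialCoeff q (lam * q.c ^ 2) n =
      (q.c ^ 2) ^ (n + 1) * qBinomialCoeff q lam (n + 1) := by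
  have h := qPoch_ne_zero q n
  have h' := qPoch_ne_zero q (n + 1)
  rw [qPoch_succ] at h'
  have h'' := right_ne_zero_of_mul h'
  rw [qBinomialCoeff, qBinomialCoeff, qBinomialCoeff, qPoch_succ q _ n, qPoch_succ q (q.c ^ 2) n,
    qPoch_succ' q lam n]
  field_simp
  ring

theorem rightAction_k11_kernelSeries (lam : ℂ) :
    rightAction q (.op (k11 q Y₁ Y₂)) (kernelSeries q Y₁ Y₂ (lam * q.c ^ 2)) =
      leftAction q (lead q Y₁ Y₂) (kernelSeries q Y₁ Y₂ lam) := by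
  set r := (q.c ^ 2)⁻¹
  set b := qBinomialCoeff q (lam * q.c ^ 2)
  have hb0 : b 0 = 1 := qBinomialCoeff_zero q _
  have hb (n : ℕ) : r ^ (n + 1) * b (n + 1) - r ^ (n + 1) * b n = qBinomialCoeff q lam (n + 1) := by
    rw [← mul_sub, qBinomialCoeff_succ_sub, inv_pow,
      inv_mul_cancel_left₀ (pow_ne_zero _ (pow_ne_zero 2 q.c_ne_zero))]
  have hsum (a : ℕ → ℂ) : Summable fun n => a n • zZetaPow q Y₁ Y₂ (n + 1) := by
    have := (summable_nat_add_iff 1).2 (summable_smul_zZetaPow q (Y₁ := Y₁) (Y₂ := Y₂)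
      fun n => a (n - 1))
    simpa only [Nat.add_sub_cancel] using this
  have hterm (n : ℕ) : rightAction q (.op (k11 q Y₁ Y₂)) (b n • zZetaPow q Y₁ Y₂ n) =
      leftAction q (lead q Y₁ Y₂) ((r ^ n * b n) • zZetaPow q Y₁ Y₂ n -
        (r ^ (n + 1) * b n) • zZetaPow q Y₁ Y₂ (n + 1)) := by
    rw [map_smul, rightAction_k11_zZetaPow, ← map_smul, smul_sub, smul_smul, smul_smul,
      mul_comm, mul_comm (b n)]
  rw [kernelSeries, (rightAction q _).map_tsum (summable_smul_zZetaPow q _), tsum_congr hterm,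
    ← (leftAction q _).map_tsum ((summable_smul_zZetaPow q _).sub (hsum _)),
    (summable_smul_zZetaPow q _).tsum_sub (hsum _),
    (summable_smul_zZetaPow q _).tsum_eq_zero_add, add_sub_assoc,
    ← (hsum fun n => r ^ (n + 1) * b (n + 1)).tsum_sub (hsum _), kernelSeries,
    (summable_smul_zZetaPow q _).tsum_eq_zero_add]
  simp only [← sub_smul, hb]
  rw [pow_zero, one_mul, hb0, qBinomialCoeff_zero]

theorem rightAction_k11_pow_kernelSeries (l : ℕ) :
    rightAction q (.op (k11 q Y₁ Y₂ ^ l)) (kernelSeries q Y₁ Y₂ (qPt q l)) =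
      leftAction q (lead q Y₁ Y₂ ^ l) (one q Y₁ Y₂) := by
  induction l with
  | zero => simp [qPt, kernelSeries_one]
  | succ l ih =>
    have hpt : (qPt q (l + 1) : ℂ) = qPt q l * q.c ^ 2 := by simp [qPt, mul_add, pow_add]
    rw [hpt, pow_succ', MulOpposite.op_mul, map_mul, mul_apply_eq_comp,
      rightAction_k11_kernelSeries, ← leftAction_rightAction, ih, pow_succ',
      leftAction_mul_apply]

end KernelSeries

section Inverse

variable (q : QParam) {Y₁ Y₂ : QSpace}

theorem entry_eq_zero_of_rightAction_k11_eq_zero {F : Dist Y₁ Y₂}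
    (hF : rightAction q (.op (k11 q Y₁ Y₂)) F = 0) {x : Position}
    (h : entry q F (x + ((-1, 0, 1), (0, -1, -1))) = 0) : entry q F x = 0 := by
  by_cases hx : x ∈ specPairs Y₁ Y₂
  swap
  · exact entry_of_notMem q _ hx
  set y : Position := x + ((0, 0, 1), (0, 0, -1)) with hy
  have hymem : y ∈ specPairs Y₁ Y₂ := by simpa [hy, specPositions] using hx
  have hyx : y + (rowShift .t12, colShift .t21) = x := by
    rw [hy, add_assoc]; exact add_zero x
  have hyx' : y + (rowShift .t11, colShift .t22) = x + ((-1, 0, 1), (0, -1, -1)) := by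
    rw [hy, add_assoc]; rfl
  have hzero := congrArg (fun G => entry q G y) hF
  simp only [k11, MulOpposite.op_sub, MulOpposite.op_smul, map_sub, map_smul, sub_apply, smul_apply,
    Pi.sub_apply, Pi.smul_apply, smul_eq_mul, map_zero, Pi.zero_apply] at hzero
  rw [entry_rightAction_t_mul_tau q _ _ _ hymem, entry_rightAction_t_mul_tau q _ _ _ hymem, hyx,
    hyx', h, mul_zero, zero_sub] at hzero
  simpa [colCoeff, rowCoeff, q.c_ne_zero, zpow_ne_zero] using hzero

theorem rightAction_k11_injective (hY : Y₁ = .principal ∨ Y₂ = .principal) :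
    Function.Injective (rightAction q (.op (k11 q Y₁ Y₂))) := by
  obtain ⟨height, height_nonneg, height_add⟩ : ∃ height : Position → ℤ,
      (∀ x ∈ specPairs Y₁ Y₂, 0 ≤ height x) ∧
        ∀ x, height (x + ((-1, 0, 1), (0, -1, -1))) = height x - 1 := by
    rcases hY with hY | hY
    · exact ⟨fun x => x.1.1, fun x hx => (hx.1 hY).1, fun x => rfl⟩
    · exact ⟨fun x => x.2.2.1, fun x hx => (hx.2 hY).2, fun x => rfl⟩
  rw [injective_iff_map_eq_zero]
  intro F hF
  have hentry (n : ℕ) : ∀ x, height x < n → entry q F x = 0 := by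
    induction n with
    | zero => exact fun x hx => entry_of_notMem q F fun hmem => (height_nonneg x hmem).not_gt hx
    | succ n ih =>
      refine fun x hx => entry_eq_zero_of_rightAction_k11_eq_zero q hF (ih _ ?_)
      rw [height_add]
      lia
  refine entry_ext q fun x _ => ?_
  rw [map_zero, hentry ((height x).toNat + 1) x (by lia), Pi.zero_apply]

theorem rightAction_k11_pow_injective (hY : Y₁ = .principal ∨ Y₂ = .principal) (l : ℕ) :
    Function.Injective (rightAction q (.op (k11 q Y₁ Y₂ ^ l))) := by
  rw [MulOpposite.op_pow, map_pow, FunLike.coe_pow_eq_iterate]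
  exact (rightAction_k11_injective q hY).iterate l

theorem isUnit_leftAction_lead_pow (l : ℕ) : IsUnit (leftAction q (lead q Y₁ Y₂ ^ l)) := by
  rw [map_pow]
  exact (isUnit_leftAction_lead q).pow l

theorem rightAction_k11_pow_leftDiv (l : ℕ) :
    rightAction q (.op (k11 q Y₁ Y₂ ^ l))
      (leftDiv q (lead q Y₁ Y₂ ^ l) (kernelSeries q Y₁ Y₂ (qPt q l))) = one q Y₁ Y₂ := by
  have hunit := isUnit_leftAction_lead_pow q (Y₁ := Y₁) (Y₂ := Y₂) l
  refine leftAction_injective q hunit ?_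
  rw [leftDiv_eq q hunit, leftAction_rightAction, leftAction_inverse_apply q hunit,
    rightAction_k11_pow_kernelSeries]

theorem isInverse_k11_pow_iff (hY : Y₁ = .principal ∨ Y₂ = .principal) (l : ℕ) (g : Dist Y₁ Y₂) :
    IsInverse q (k11 q Y₁ Y₂ ^ l) g ↔
      g = leftDiv q (lead q Y₁ Y₂ ^ l) (kernelSeries q Y₁ Y₂ (qPt q l)) := by
  have hright := rightAction_k11_pow_leftDiv q (Y₁ := Y₁) (Y₂ := Y₂) l
  have hinj := rightAction_k11_pow_injective q hY l
  rw [IsInverse, ← coe_leftAction, ← coe_rightAction]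
  refine ⟨fun h => hinj (h.2.trans hright.symm), ?_⟩
  rintro rfl
  refine ⟨hinj ?_, hright⟩
  rw [← leftAction_rightAction, hright, leftAction_one, rightAction_one]

end Inverse

section TraceForm

variable (q : QParam) {Y₁ Y₂ : QSpace}

/-- The transposed position: the entry there is paired with the given one in the trace of a product
of two matrices. -/
def transpose (x : ℤ × ℤ × ℤ) : ℤ × ℤ × ℤ := (x.2.1, x.1, -x.2.2)

/-- The transposed position in both factors. -/
def dual (x : Position) : Position := (transpose x.1, transpose x.2)

theorem dual_involutive : Function.Involutive dual := fun _ => by simp [dual, transpose]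

theorem dual_mem_specPairs {x : Position} : dual x ∈ specPairs Y₁ Y₂ ↔ x ∈ specPairs Y₁ Y₂ := by
  simp only [Set.mem_prod, specPositions, dual, transpose, Set.mem_ofPred_eq,
    and_comm (a := 0 ≤ x.1.2.1), and_comm (a := 0 ≤ x.2.2.1)]

theorem dual_diagonal (m : Y₁.Spec × Y₂.Spec) :
    dual (Prod.map diagonal diagonal m) = Prod.map diagonal diagonal m := rfl

theorem dual_mem_range_diagonal {x : Position} :
    dual x ∈ Set.range (Prod.map (diagonal (Y := Y₁)) (diagonal (Y := Y₂))) ↔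
      x ∈ Set.range (Prod.map (diagonal (Y := Y₁)) (diagonal (Y := Y₂))) :=
  exists_congr fun m => by
    rw [← dual_diagonal, dual_involutive.injective.eq_iff, dual_diagonal]

/-- The weight of the product measure `ν₁ × ν₂` at the rows of a position. -/
noncomputable def density (x : Position) : ℂ :=
  (1 - q.c ^ 2) ^ 2 * q.c ^ (-2 * x.1.1) * q.c ^ (-2 * x.2.2.1)

theorem density_ne_zero (x : Position) : density q x ≠ 0 :=
  mul_ne_zero (mul_ne_zero (pow_ne_zero _ (sub_ne_zero.2 (q.c_pow_ne_one 2 two_ne_zero).symm))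
    (zpow_ne_zero _ q.c_ne_zero)) (zpow_ne_zero _ q.c_ne_zero)

/-- The weighted trace of the product of the matrices of a distribution and of a finite
function. -/
noncomputable def traceForm (F ψ : Dist Y₁ Y₂) : ℂ :=
  ∑ᶠ x, density q x * entry q F (dual x) * entry q ψ x

theorem support_entry (ψ : Dist Y₁ Y₂) :
    Function.support (entry q ψ) = position '' Function.support ψ := by
  refine Set.Subset.antisymm (fun x hx => ?_) ?_
  · obtain ⟨u, rfl⟩ := (range_position Y₁ Y₂).symm ▸
      by_contra fun h => hx (entry_of_notMem q ψ h)
    rw [Function.mem_support, entry_position] at hx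
    exact ⟨u, right_ne_zero_of_mul hx, rfl⟩
  · rintro _ ⟨u, hu, rfl⟩
    rw [Function.mem_support, entry_position]
    exact mul_ne_zero (weight_ne_zero q u) hu

theorem isFiniteFunction_iff {ψ : Dist Y₁ Y₂} :
    IsFiniteFunction ψ ↔ (Function.support (entry q ψ)).Finite := by
  rw [support_entry, Set.finite_image_iff position_injective.injOn, IsFiniteFunction]

theorem traceForm_eq_sum {ψ : Dist Y₁ Y₂} {s : Finset Position}
    (hs : Function.support (entry q ψ) ⊆ s) (F : Dist Y₁ Y₂) :
    traceForm q F ψ = ∑ x ∈ s, density q x * entry q F (dual x) * entry q ψ x :=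
  finsum_eq_sum_of_support_subset _ ((Function.support_mul_subset_right _ _).trans hs)

theorem continuous_traceForm {ψ : Dist Y₁ Y₂} (hψ : IsFiniteFunction ψ) :
    Continuous fun F => traceForm q F ψ := by
  rw [isFiniteFunction_iff q] at hψ
  simp only [traceForm_eq_sum q hψ.coe_toFinset.ge]
  fun_prop

theorem traceForm_add_left {ψ : Dist Y₁ Y₂} (hψ : IsFiniteFunction ψ) (F G : Dist Y₁ Y₂) :
    traceForm q (F + G) ψ = traceForm q F ψ + traceForm q G ψ := by
  rw [isFiniteFunction_iff q] at hψ
  simp only [traceForm_eq_sum q hψ.coe_toFinset.ge, ← Finset.sum_add_distrib, map_add,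
    Pi.add_apply, mul_add, add_mul]

theorem traceForm_add_right {ψ φ : Dist Y₁ Y₂} (hψ : IsFiniteFunction ψ)
    (hφ : IsFiniteFunction φ) (F : Dist Y₁ Y₂) :
    traceForm q F (ψ + φ) = traceForm q F ψ + traceForm q F φ := by
  rw [isFiniteFunction_iff q] at hψ hφ
  rw [traceForm, traceForm, traceForm, ← finsum_add_distrib]
  · simp only [map_add, Pi.add_apply, mul_add]
  · exact hψ.subset (Function.support_mul_subset_right _ _)
  · exact hφ.subset (Function.support_mul_subset_right _ _)

theorem traceForm_smul_left (c : ℂ) (F ψ : Dist Y₁ Y₂) :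
    traceForm q (c • F) ψ = c * traceForm q F ψ := by
  rw [traceForm, traceForm, ← smul_eq_mul, smul_finsum]
  simp only [map_smul, Pi.smul_apply, smul_eq_mul, mul_left_comm, mul_assoc]

theorem traceForm_smul_right (c : ℂ) (F ψ : Dist Y₁ Y₂) :
    traceForm q F (c • ψ) = c * traceForm q F ψ := by
  rw [traceForm, traceForm, ← smul_eq_mul, smul_finsum]
  simp only [map_smul, Pi.smul_apply, smul_eq_mul, mul_left_comm]

theorem IsFiniteFunction.add {ψ φ : Dist Y₁ Y₂} (hψ : IsFiniteFunction ψ)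
    (hφ : IsFiniteFunction φ) : IsFiniteFunction (ψ + φ) :=
  (Set.Finite.union hψ hφ).subset (Function.support_add ψ φ)

theorem IsFiniteFunction.smul {ψ : Dist Y₁ Y₂} (hψ : IsFiniteFunction ψ) (c : ℂ) :
    IsFiniteFunction (c • ψ) :=
  Set.Finite.subset hψ (Function.support_const_smul_subset c ψ)

theorem IsFiniteFunction.weightedShift {ψ : Dist Y₁ Y₂} (hψ : IsFiniteFunction ψ)
    (c : Position → ℂ) (v : Position) : IsFiniteFunction (weightedShift q c v ψ) := by
  rw [isFiniteFunction_iff q] at hψ ⊢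
  refine (hψ.preimage (f := (· + v)) (add_left_injective v).injOn).subset fun x hx => ?_
  have hmem : x ∈ specPairs Y₁ Y₂ := by_contra fun h => hx (entry_of_notMem q _ h)
  rw [Function.mem_support, entry_weightedShift q _ _ _ hmem] at hx
  exact right_ne_zero_of_mul hx

theorem traceForm_weightedShift {c c' : Position → ℂ} {v v' : Position}
    (hdual : ∀ x, dual (x + v) + v' = dual x) (hc : ∀ x, c' (dual (x + v)) = c x)
    (hdensity : ∀ x, density q (x + v) = density q x) (F ψ : Dist Y₁ Y₂) :
    traceForm q (weightedShift q c' v' F) ψ = traceForm q F (weightedShift q c v ψ) := by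
  rw [traceForm, traceForm, ← finsum_comp_equiv (Equiv.addRight v)]
  refine finsum_congr fun x => ?_
  rw [Equiv.coe_addRight, hdensity]
  by_cases hx : x ∈ specPairs Y₁ Y₂
  · rw [entry_weightedShift q c v ψ hx]
    by_cases hxv : x + v ∈ specPairs Y₁ Y₂
    · rw [entry_weightedShift q c' v' F (dual_mem_specPairs.2 hxv), hdual, hc]
      ring
    · rw [entry_of_notMem q ψ hxv, mul_zero, mul_zero, mul_zero]
  · rw [entry_of_notMem q (QSU.weightedShift q c v ψ) hx, mul_zero]
    by_cases hxv : dual (x + v) ∈ specPairs Y₁ Y₂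
    · rw [entry_weightedShift q c' v' F hxv, hdual,
        entry_of_notMem q F (mt dual_mem_specPairs.1 hx), mul_zero, mul_zero, zero_mul]
    · rw [entry_of_notMem q _ hxv, mul_zero, zero_mul]

variable (Y₁ Y₂) in
/-- The elements of `Pol(Y₁ × Y₂)_q` which preserve finite functions and whose left and right
actions are adjoint for the trace form. -/
def adjointable : Subalgebra ℂ (PolProd q Y₁ Y₂) where
  carrier := {K | ∀ ψ, IsFiniteFunction ψ → IsFiniteFunction (leftAction q K ψ) ∧
    ∀ F, traceForm q (rightAction q (.op K) F) ψ = traceForm q F (leftAction q K ψ)}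
  mul_mem' {K L} hK hL ψ hψ := by
    obtain ⟨hψL, hL⟩ := hL ψ hψ
    obtain ⟨hψK, hK⟩ := hK _ hψL
    rw [leftAction_mul_apply]
    refine ⟨hψK, fun F => ?_⟩
    rw [MulOpposite.op_mul, map_mul, mul_apply_eq_comp, hL, hK]
  add_mem' {K L} hK hL ψ hψ := by
    obtain ⟨hψK, hK⟩ := hK ψ hψ
    obtain ⟨hψL, hL⟩ := hL ψ hψ
    rw [map_add, add_apply]
    refine ⟨hψK.add hψL, fun F => ?_⟩
    rw [MulOpposite.op_add, map_add, add_apply, traceForm_add_left q hψ, hK, hL,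
      traceForm_add_right q hψK hψL]
  algebraMap_mem' c ψ hψ := by
    rw [Algebra.algebraMap_eq_smul_one, map_smul, map_one, smul_apply, one_apply_eq_self]
    refine ⟨hψ.smul c, fun F => ?_⟩
    rw [MulOpposite.op_smul, MulOpposite.op_one, map_smul, map_one, smul_apply, one_apply_eq_self,
      traceForm_smul_left, traceForm_smul_right]

theorem adjointable_eq_top : adjointable q Y₁ Y₂ = ⊤ := by
  rw [← top_le_iff, ← adjoin_range_t_union_range_tau, Algebra.adjoin_le_iff]
  rintro _ (⟨g, rfl⟩ | ⟨g, rfl⟩) ψ hψ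
  · rw [t, leftAction_tmul q (isMatrixShift_mul_gen q Y₁ g) (isMatrixShift_one_mul q Y₂),
      rightAction_tmul q (isMatrixShift_gen_mul q Y₁ g) (isMatrixShift_mul_one q Y₂)]
    refine ⟨hψ.weightedShift q _ _, fun F => traceForm_weightedShift q ?_ ?_ ?_ F ψ⟩ <;> intro x
    · cases g <;> simp [dual, transpose, colShift, rowShift]
    · cases g <;> simp [dual, transpose, colShift, colCoeff, rowCoeff]
    · cases g <;> simp [density, colShift]
  · rw [tau, ← MulOpposite.op_one,
      leftAction_tmul q (isMatrixShift_mul_one q Y₁) (isMatrixShift_gen_mul q Y₂ g),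
      rightAction_tmul q (isMatrixShift_one_mul q Y₁) (isMatrixShift_mul_gen q Y₂ g)]
    refine ⟨hψ.weightedShift q _ _, fun F => traceForm_weightedShift q ?_ ?_ ?_ F ψ⟩ <;> intro x
    · cases g <;> simp [dual, transpose, colShift, rowShift]
    · cases g <;> simp [dual, transpose, rowShift, colCoeff, rowCoeff]
    · cases g <;> simp [density, rowShift]

theorem integral_eq_traceForm (ψ : Dist Y₁ Y₂) : integral q ψ = traceForm q (one q Y₁ Y₂) ψ := by
  have htrace : traceForm q (one q Y₁ Y₂) ψ =
      ∑ᶠ x ∈ Set.range (Prod.map (diagonal (Y := Y₁)) (diagonal (Y := Y₂))),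
        density q x * entry q ψ x := by
    rw [traceForm, finsum_mem_def, entry_one]
    refine finsum_congr fun x => ?_
    by_cases hx : x ∈ Set.range (Prod.map (diagonal (Y := Y₁)) (diagonal (Y := Y₂)))
    · rw [Set.indicator_of_mem hx, Set.indicator_of_mem (dual_mem_range_diagonal.2 hx),
        Pi.one_apply, mul_one]
    · rw [Set.indicator_of_notMem hx, Set.indicator_of_notMem (mt dual_mem_range_diagonal.1 hx),
        mul_zero, zero_mul]
  have hentry (m : Y₁.Spec × Y₂.Spec) : entry q ψ (Prod.map diagonal diagonal m) =
      ψ ((MIdx.zero, m.1), (MIdx.zero, m.2)) := by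
    have hpos : Prod.map diagonal diagonal m =
        position ((MIdx.zero, m.1), (MIdx.zero, m.2)) := by
      simp [position, specPosition, matrixPosition, Prod.map, diagonal, MIdx.zero]
    rw [hpos, entry_position]
    simp [weight, entryRatio, MIdx.zero]
  rw [htrace, finsum_mem_range ((diagonal_injective Y₁).prodMap (diagonal_injective Y₂)),
    integral, ← smul_eq_mul, smul_finsum]
  refine finsum_congr fun m => ?_
  rw [hentry, smul_eq_mul, density]
  simp only [diagonal, Prod.map_fst, Prod.map_snd]
  ring

theorem pairing_eq_traceForm {ψ : Dist Y₁ Y₂} (hψ : IsFiniteFunction ψ) (F : Dist Y₁ Y₂) :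
    pairing q F ψ = traceForm q F ψ := by
  refine limUnder_toDist q (continuous_traceForm q hψ) (fun p => ?_) F
  have hp : p ∈ adjointable q Y₁ Y₂ := adjointable_eq_top q ▸ Algebra.mem_top
  rw [integral_eq_traceForm, ← coe_leftAction, ← (hp ψ hψ).2, rightAction_one]

theorem pairing_single [DecidableEq MIdx] (F : Dist Y₁ Y₂)
    (u : (MIdx × Y₁.Spec) × (MIdx × Y₂.Spec)) :
    pairing q F (Pi.single u 1) =
      density q (position u) * entry q F (dual (position u)) * weight q u := by
  have hfinite : IsFiniteFunction (Pi.single u 1 : Dist Y₁ Y₂) :=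
    (Set.finite_singleton u).subset Pi.support_single_subset
  have hsupp : Function.support (entry q (Pi.single u 1 : Dist Y₁ Y₂)) ⊆
      ({position u} : Finset Position) := by
    rw [support_entry, Finset.coe_singleton, ← Set.image_singleton]
    exact Set.image_mono Pi.support_single_subset
  rw [pairing_eq_traceForm q hfinite, traceForm_eq_sum q hsupp, Finset.sum_singleton,
    entry_position, Pi.single_eq_same, mul_one]

theorem eq_of_forall_pairing {F G : Dist Y₁ Y₂}
    (h : ∀ ψ, IsFiniteFunction ψ → pairing q F ψ = pairing q G ψ) : F = G := by
  classical
  refine entry_ext q fun x hx => ?_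
  obtain ⟨u, hu⟩ : dual x ∈ Set.range position := by
    rwa [range_position, dual_mem_specPairs]
  have hpair := h (Pi.single u 1) ((Set.finite_singleton u).subset Pi.support_single_subset)
  rw [pairing_single, pairing_single, hu, dual_involutive] at hpair
  exact mul_left_cancel₀ (density_ne_zero q _) (mul_right_cancel₀ (weight_ne_zero q u) hpair)

end TraceForm

section Laurent

theorem smeval_eq_eval₂ {R S : Type*} [CommSemiring R] [CommSemiring S] [Algebra R S]
    (P : LaurentPolynomial R) (x : Sˣ) :
    P.smeval x = LaurentPolynomial.eval₂ (algebraMap R S) x P := by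
  induction P using LaurentPolynomial.induction_on' with
  | add P Q hP hQ => rw [LaurentPolynomial.smeval_add, hP, hQ, map_add]
  | C_mul_T n a =>
    rw [LaurentPolynomial.smeval_C_mul_T_n, LaurentPolynomial.eval₂_C_mul_T, Algebra.smul_def]

theorem smeval_toLaurent {R S : Type*} [CommSemiring R] [CommSemiring S] [Algebra R S]
    (P : R[X]) (x : Sˣ) : (Polynomial.toLaurent P).smeval x = aeval (x : S) P := by
  rw [smeval_eq_eval₂, LaurentPolynomial.eval₂_toLaurent, aeval_def]

theorem eq_of_infinite_smeval_eq {R : Type*} [CommRing R] [IsDomain R]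
    {P Q : LaurentPolynomial R} {s : Set Rˣ} (hs : s.Infinite)
    (h : ∀ x ∈ s, P.smeval x = Q.smeval x) : P = Q := by
  obtain ⟨n, N, hN⟩ := LaurentPolynomial.exists_T_pow (P - Q)
  have hroot : ∀ x ∈ s, N.IsRoot x := fun x hx => by
    have hPQ : LaurentPolynomial.eval₂ (algebraMap R R) x (P - Q) = 0 := by
      rw [map_sub, ← smeval_eq_eval₂, ← smeval_eq_eval₂, h x hx, sub_self]
    rw [IsRoot, ← coe_aeval_eq_eval, ← smeval_toLaurent, smeval_eq_eval₂, hN, map_mul, hPQ,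
      zero_mul]
  have hN0 : N = 0 := eq_zero_of_infinite_isRoot N
    ((hs.image Units.val_injective.injOn).mono (Set.image_subset_iff.2 hroot))
  rw [hN0, map_zero, eq_comm, (LaurentPolynomial.isUnit_T n).mul_left_eq_zero] at hN
  exact sub_eq_zero.1 hN

end Laurent

section PolynomialVF

variable (q : QParam) {Y₁ Y₂ : QSpace}

theorem qPt_injective : Function.Injective (qPt q) := fun l k h => by
  have hpow : q.val ^ (2 * l) = q.val ^ (2 * k) := by
    simpa [qPt, QParam.c, Units.ext_iff, ← Complex.ofReal_pow] using h
  have := pow_right_injective₀ q.pos q.lt_one.ne hpow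
  lia

theorem IsPolynomialVF.ext {f g : ℂˣ → Dist Y₁ Y₂} (hf : IsPolynomialVF q f)
    (hg : IsPolynomialVF q g) (h : ∀ l, f (qPt q l) = g (qPt q l)) : f = g := by
  funext lam
  refine eq_of_forall_pairing q fun ψ hψ => ?_
  obtain ⟨P, hP⟩ := hf ψ hψ
  obtain ⟨Q, hQ⟩ := hg ψ hψ
  have hPQ : P = Q := by
    refine eq_of_infinite_smeval_eq (Set.infinite_range_of_injective (qPt_injective q)) ?_
    rintro _ ⟨l, rfl⟩
    rw [← hP, ← hQ, h]
  rw [hP, hQ, hPQ]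

theorem IsPolynomialVF.of_eval {f : ℂˣ → Dist Y₁ Y₂}
    (P : (MIdx × Y₁.Spec) × (MIdx × Y₂.Spec) → ℂ[X])
    (hP : ∀ lam u, f lam u = (P u).eval (lam : ℂ)) : IsPolynomialVF q f := by
  intro ψ hψ
  have hentry (x : Position) : ∃ Q : ℂ[X], ∀ lam, entry q (f lam) x = Q.eval (lam : ℂ) := by
    by_cases hx : x ∈ specPairs Y₁ Y₂
    · obtain ⟨u, rfl⟩ := (range_position Y₁ Y₂).symm ▸ hx
      exact ⟨C (weight q u) * P u, fun lam => by rw [entry_position, hP, eval_mul, eval_C]⟩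
    · exact ⟨0, fun lam => by rw [entry_of_notMem q _ hx, eval_zero]⟩
  choose Q hQ using hentry
  have hsupp := ((isFiniteFunction_iff q).1 hψ).coe_toFinset.ge
  refine ⟨Polynomial.toLaurent (∑ x ∈ ((isFiniteFunction_iff q).1 hψ).toFinset,
    C (density q x) * Q (dual x) * C (entry q ψ x)), fun lam => ?_⟩
  rw [smeval_toLaurent, coe_aeval_eq_eval, pairing_eq_traceForm q hψ, traceForm_eq_sum q hsupp,
    eval_finsetSum]
  simp only [eval_mul, eval_C, hQ]

theorem exists_eval_eq_qPoch (n : ℕ) : ∃ P : ℂ[X], ∀ a, P.eval a = qPoch q a n :=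
  ⟨∏ j ∈ Finset.range n, (1 - X * C (q.c ^ (2 * j))), fun a => by simp [qPoch, eval_prod]⟩

theorem isPolynomialVF_kernelSeries :
    IsPolynomialVF q fun lam : ℂˣ => kernelSeries q Y₁ Y₂ lam := by
  choose P hP using exists_eval_eq_qPoch q
  refine IsPolynomialVF.of_eval q (fun u => P u.1.1.i1 *
    C ((qPoch q (q.c ^ 2) u.1.1.i1)⁻¹ * zZetaPow q Y₁ Y₂ u.1.1.i1 u)) fun lam u => ?_
  rw [kernelSeries_apply, qBinomialCoeff, eval_mul, eval_C, hP, div_eq_mul_inv, mul_assoc]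

end PolynomialVF

end QSU

theorem proposition6p9 (q : QSU.QParam) (Y₁ Y₂ : QSU.QSpace)
    (hY : Y₁ = QSU.QSpace.principal ∨ Y₂ = QSU.QSpace.principal) :
    -- the elements inverted below act bijectively on distributions
    Function.Bijective (QSU.leftMul q (QSU.t q Y₁ Y₂ .t12)) ∧
    Function.Bijective (QSU.leftMul q (QSU.tau q Y₁ Y₂ .t21)) ∧
    (∀ l : ℕ, Function.Bijective (QSU.leftMul q (QSU.lead q Y₁ Y₂ ^ l))) ∧
    -- `kinv l` is the unique inverse of `k₁₁ ^ l`, that is, `k₁₁ ^ (-l)`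
    ∃ kinv : ℕ → QSU.Dist Y₁ Y₂,
      (∀ (l : ℕ) (g : QSU.Dist Y₁ Y₂), QSU.IsInverse q (QSU.k11 q Y₁ Y₂ ^ l) g ↔ g = kinv l) ∧
      ∃ f : ℂˣ → QSU.Dist Y₁ Y₂,
        (QSU.IsPolynomialVF q f ∧
          ∀ l : ℕ, kinv l = QSU.leftDiv q (QSU.lead q Y₁ Y₂ ^ l) (f (QSU.qPt q l))) ∧
        (∀ f' : ℂˣ → QSU.Dist Y₁ Y₂,
          (QSU.IsPolynomialVF q f' ∧
            ∀ l : ℕ, kinv l = QSU.leftDiv q (QSU.lead q Y₁ Y₂ ^ l) (f' (QSU.qPt q l))) →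
          f' = f) ∧
        ∀ lam : ℂˣ, HasSum
          (fun n : ℕ => (QSU.qPoch q lam n / QSU.qPoch q (q.c ^ 2) n) • QSU.zZetaPow q Y₁ Y₂ n)
          (f lam) := by
  refine ⟨QSU.bijective_leftMul q (QSU.isUnit_leftAction_t12 q),
    QSU.bijective_leftMul q (QSU.isUnit_leftAction_tau21 q),
    fun l => QSU.bijective_leftMul q (QSU.isUnit_leftAction_lead_pow q l),
    fun l => QSU.leftDiv q (QSU.lead q Y₁ Y₂ ^ l) (QSU.kernelSeries q Y₁ Y₂ (QSU.qPt q l)),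
    QSU.isInverse_k11_pow_iff q hY, fun lam => QSU.kernelSeries q Y₁ Y₂ lam,
    ⟨QSU.isPolynomialVF_kernelSeries q, fun _ => rfl⟩, ?_,
    fun lam => (QSU.summable_smul_zZetaPow q _).hasSum⟩
  rintro f' ⟨hf', hkinv⟩
  exact hf'.ext q (QSU.isPolynomialVF_kernelSeries q) fun l =>
    QSU.leftDiv_injective q (QSU.isUnit_leftAction_lead_pow q l) (hkinv l).symm
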